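/- Let $d\ge 2$, and let $\mathbb{L}^d$ be the graph with vertex set $\mathbb{Z}^d$ and bond set $\mathbb{E}^d=\{\{x,y\}:\|x-y\|=1\}$, where $\|x\|=\sum_{i=1}^d|x_i|$. Put $\Omega=\{0,1\}^{\mathbb{E}^d}$ (with $1$ meaning open), with its product topology, product $\sigma$-field and product order. For a finite set $\Lambda\subset\mathbb{Z}^d$ let $\mathbb{E}_\Lambda$ be the set of bonds with both end points in $\Lambda$, let $\sigma(\Lambda)$ be the $\sigma$-field on $\Omega$ generated by the states of the bonds in $\mathbb{E}_\Lambda$, and let $\partial\Lambda=\{y\notin\Lambda:\exists x\in\Lambda,\ \|x-y\|=1\}$. Let $d(\Lambda_1,\Lambda_2)=\min\{\|x-y\|:x\in\Lambda_1,\,y\in\Lambda_2\}$. For $p\in[0,1]$, $q>0$, a finite set $\Lambda\subset\mathbb{Z}^d$ and a boundary condition $\eta\in\Omega$, let $\phi^{\eta}_{\Lambda,p,q}$ be the probability measure on $\Omega$ carried by the configurations $\omega$ with $\omega=\eta$ off $\mathbb{E}_\Lambda$ and giving to each of them probability proportional to $$\Big\{\prod_{e\in\mathbb{E}_\Lambda}p^{\omega(e)}(1-p)^{1-\omega(e)}\Big\}\,q^{k(\omega)},$$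 where $k(\omega)$ is the number of connected components of the graph of open bonds of $\omega$ on $\mathbb{Z}^d$ that contain an end point of a bond of $\mathbb{E}_\Lambda$. Let $\mathcal{R}_{p,q}$ be the set of random-cluster measures, that is, of the probability measures $\phi$ on $\Omega$ with $\phi(A)=\int\phi^{\eta}_{\Lambda,p,q}(A)\,d\phi(\eta)$ for every measurable $A$ and every finite $\Lambda$. For $b\in\{0,1\}$ let $\phi^b_{p,q}$ be the weak limit, as $n\to\infty$, of the measures $\phi^{\eta}_{\Lambda,p,q}$ with $\Lambda=\{-n,\dots,n\}^d$ and $\eta\equiv b$. Let $q\ge 1$ and $\frac{q}{q+4^{-d}}<p\le 1$. Then there exist constants $C>0$ and $\alpha>0$, depending only on $d$, $p$ and $q$, such that for each random-cluster measure $\phi\in\mathcal{R}_{p,q}$, and also for $\phi=\phi^0_{p,q}$ and $\phi=\phi^1_{p,q}$, for all nonempty finite connected sets $\Lambda_1,\Lambda_2\subset\mathbb{Z}^d$ and all monotone events $A$ and $B$ (each of them increasing or decreasing) such that $A$ is $\sigma(\Lambda_1)$-measurable and $B$ is $\sigma(\Lambda_2)$-measurable, $$|\mathrm{Cov}_{\phi}(A,B)|=|\phi(A\cap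 B)-\phi(A)\phi(B)|\le C\,|\partial\Lambda_1|\,e^{-\alpha\, d(\Lambda_1,\Lambda_2)}.$$ -/

import Mathlib

open MeasureTheory Filter Topology

namespace RandomCluster

/-- The `ℓ¹` distance `‖x - y‖` on `ℤ^d`. -/
def l1Dist {d : ℕ} (x y : Fin d → ℤ) : ℕ := ∑ i, (x i - y i).natAbs

/-- The hypercubic lattice `𝕃^d`: vertices `ℤ^d`, bonds between points at `ℓ¹` distance one. -/
def lattice (d : ℕ) : SimpleGraph (Fin d → ℤ) where
  Adj x y := l1Dist x y = 1
  symm := ⟨fun x y h => by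
    have h' : l1Dist y x = l1Dist x y :=
      Finset.sum_congr rfl fun i _ => by rw [← Int.natAbs_neg, neg_sub]
    exact h'.trans h⟩
  loopless := ⟨fun x h => by simp [l1Dist] at h⟩

/-- The set of bonds `𝔼^d`, as a type. -/
abbrev Bond (d : ℕ) : Type := (lattice d).edgeSet

/-- Configurations `Ω = {0,1}^{𝔼^d}` (`true` = open), with the product topology, the product
`σ`-field and the product order. -/
abbrev Config (d : ℕ) : Type := Bond d → Bool

open Classical in
/-- The set `𝔼_Λ` of the bonds both of whose end points lie in `Λ`. -/
noncomputable def innerBonds {d : ℕ} (Λ : Finset (Fin d → ℤ)) : Finset (Bond d) :=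
  Λ.sym2.subtype (· ∈ (lattice d).edgeSet)

theorem mem_innerBonds {d : ℕ} (Λ : Finset (Fin d → ℤ)) (e : Bond d) :
    e ∈ innerBonds Λ ↔ ∀ x ∈ (e : Sym2 (Fin d → ℤ)), x ∈ Λ := by
  simp [innerBonds, Finset.mem_sym2_iff]

/-- The outer vertex boundary `∂Λ`. -/
def boundary {d : ℕ} (Λ : Finset (Fin d → ℤ)) : Set (Fin d → ℤ) :=
  {y | y ∉ Λ ∧ ∃ x ∈ Λ, l1Dist x y = 1}

/-- The distance `d(Λ₁, Λ₂) = min {‖x - y‖ : x ∈ Λ₁, y ∈ Λ₂}` of two nonempty sets. -/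
noncomputable def setDist {d : ℕ} (Λ₁ Λ₂ : Finset (Fin d → ℤ)) : ℕ :=
  sInf {n | ∃ x ∈ Λ₁, ∃ y ∈ Λ₂, l1Dist x y = n}

/-- `Λ` is a (nonempty) connected set of vertices of `𝕃^d`. -/
def IsConnectedVolume {d : ℕ} (Λ : Finset (Fin d → ℤ)) : Prop :=
  ((lattice d).induce (Λ : Set (Fin d → ℤ))).Connected

/-- The graph on `ℤ^d` whose edges are the open bonds of `ω`. -/
def openGraph {d : ℕ} (ω : Config d) : SimpleGraph (Fin d → ℤ) :=
  SimpleGraph.fromEdgeSet {e | ∃ h : e ∈ (lattice d).edgeSet, ω ⟨e, h⟩ = true}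

/-- The number `k` of open clusters (finite or infinite) of `ω` that contain an end point of a
bond of `E`. -/
noncomputable def clusterCount {d : ℕ} (E : Finset (Bond d)) (ω : Config d) : ℕ :=
  Set.ncard {c : (openGraph ω).ConnectedComponent |
    ∃ e ∈ E, ∃ x ∈ (e : Sym2 (Fin d → ℤ)), (openGraph ω).connectedComponentMk x = c}

open Classical in
/-- The concatenation `ζ η_{E^c}`: it is `ζ` on `E` and `η` off `E`. -/
noncomputable def glue {d : ℕ} (E : Finset (Bond d)) (ζ : E → Bool) (η : Config d) : Config d :=
  fun e => if h : e ∈ E then ζ ⟨e, h⟩ else η e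

/-- The unnormalised weight `∏_{e ∈ E} p^{ω(e)} (1-p)^{1-ω(e)} · q^{k(ω)}`. -/
noncomputable def weight {d : ℕ} (p q : ℝ) (E : Finset (Bond d)) (ω : Config d) : ℝ :=
  (∏ e ∈ E, if ω e = true then p else 1 - p) * q ^ clusterCount E ω

/-- The normalising constant `Z_{E,p,q}^η`. -/
noncomputable def partitionFunction {d : ℕ} (p q : ℝ) (E : Finset (Bond d)) (η : Config d) : ℝ :=
  ∑ ζ : E → Bool, weight p q E (glue E ζ η)

/-- The finite-volume random-cluster measure `φ_{E,p,q}^η` with boundary condition `η`. -/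
noncomputable def finiteMeasure {d : ℕ} (p q : ℝ) (E : Finset (Bond d)) (η : Config d) :
    Measure (Config d) :=
  ∑ ζ : E → Bool, ENNReal.ofReal (weight p q E (glue E ζ η) / partitionFunction p q E η) •
    Measure.dirac (glue E ζ η)

/-- `φ ∈ 𝓡_{p,q}`: the probability measure `φ` on `Ω` satisfies the DLR condition
`φ(A) = ∫ φ_{Λ,p,q}^η(A) dφ(η)` for all measurable `A` and all finite `Λ ⊂ ℤ^d`. -/
def IsRandomCluster {d : ℕ} (p q : ℝ) (φ : Measure (Config d)) : Prop :=
  IsProbabilityMeasure φ ∧ ∀ (A : Set (Config d)), MeasurableSet A →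
    ∀ Λ : Finset (Fin d → ℤ), φ A = ∫⁻ η, finiteMeasure p q (innerBonds Λ) η A ∂φ

/-- The box `{x ∈ ℤ^d : ‖x‖_∞ ≤ n}`. -/
noncomputable def box (d n : ℕ) : Finset (Fin d → ℤ) := Fintype.piFinset fun _ => Finset.Icc (-(n : ℤ)) n

/-- `φ = φ_{p,q}^b`: the probability measure `φ` on `Ω` is the weak limit of the finite-volume
measures `φ_{Λ_n,p,q}^b` in the boxes `Λ_n`, the boundary condition being free for `b = false`
and wired for `b = true`. (As `Ω` is compact, every continuous function is bounded.) -/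
def IsInfiniteVolumeLimit {d : ℕ} (p q : ℝ) (b : Bool) (φ : Measure (Config d)) : Prop :=
  IsProbabilityMeasure φ ∧ ∀ f : Config d → ℝ, Continuous f →
    Tendsto (fun n : ℕ => ∫ ω, f ω ∂(finiteMeasure p q (innerBonds (box d n)) fun _ => b))
      atTop (𝓝 (∫ ω, f ω ∂φ))

/-- A monotone event: increasing or decreasing. -/
def IsMonotoneEvent {d : ℕ} (A : Set (Config d)) : Prop := IsUpperSet A ∨ IsLowerSet A

/-- The `σ`-field `σ(Λ)` generated by the states of the bonds in `𝔼_Λ`. -/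
abbrev sigmaField {d : ℕ} (Λ : Finset (Fin d → ℤ)) : MeasurableSpace (Config d) :=
  cylinderEvents (X := fun _ : Bond d => Bool) (innerBonds Λ : Set (Bond d))

end RandomCluster

open MeasureTheory Filter Topology

namespace RandomCluster

variable {d : ℕ} {p q : ℝ}

/-! Let r be the distance from Λ₁ to Λ₂, let D be the (r-1)-neighbourhood of Λ₁, and let A be
increasing (complements handle decreasing A). The event B depends only on bonds outside E = 𝔼_D.
Conditionally on those bonds, the probability of A lies between its free and its wired value on E,
and so does its unconditional probability (`sandwich`). Hence |Cov| is at most the wired value minus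
the free value.

To bound this gap, take the free measure on E and explore from outside every closed bond linked to
the complement of E by closed bonds, consecutive ones lying in a common unit square. The unexplored
set F is determined by the states off F and is shielded by open bonds. Cochains on ℤ^d that are
closed on unit squares are exact. It follows that the ends of a bond of F are connected exactly when
they would be with everything off F open (`endsJoined_glue_of_shielded`). Given F, the law on F is
therefore wired, and for increasing events it dominates the wired law on E. So the gap is at most
the probability that some bond of 𝔼_{Λ₁} is explored (`expect_wired_sub_expect_le`).

A Peierls argument bounds that probability (`expect_not_subset_unexplored_le`). Exploring 𝔼_{Λ₁}
forces a self-avoiding chain of r-2 closed bonds, starting next to a bond count of order |∂Λ₁|.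
There are at most 4^d choices per step, and n given bonds are all closed with probability at most
(q(1-p)/p)^n. The assumption on p says exactly that 4^d q(1-p)/p < 1. -/

/-! ### Open clusters and the effect of opening one bond. -/

theorem openGraph_adj {ω : Config d} {x y : Fin d → ℤ} :
    (openGraph ω).Adj x y ↔ ∃ h : (lattice d).Adj x y, ω ⟨s(x, y), h⟩ = true := by
  simp only [openGraph, SimpleGraph.fromEdgeSet_adj, Set.mem_ofPred_eq, SimpleGraph.mem_edgeSet]
  exact ⟨fun h => h.1, fun h => ⟨h, h.1.ne⟩⟩

theorem openGraph_mono {ω ω' : Config d} (h : ω ≤ ω') : openGraph ω ≤ openGraph ω' := by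
  intro x y hxy
  obtain ⟨hl, ho⟩ := openGraph_adj.1 hxy
  refine openGraph_adj.2 ⟨hl, ?_⟩
  have := h ⟨s(x, y), hl⟩
  rw [ho] at this
  exact le_antisymm le_top this

/-- The end points of the bond `e` lie in the same open cluster of `ω`. -/
def EndsJoined (ω : Config d) (e : Bond d) : Prop :=
  ∀ x ∈ (e : Sym2 (Fin d → ℤ)), ∀ y ∈ (e : Sym2 (Fin d → ℤ)), (openGraph ω).Reachable x y

theorem endsJoined_mk {ω : Config d} {a b : Fin d → ℤ} {h : s(a, b) ∈ (lattice d).edgeSet} :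
    EndsJoined ω ⟨s(a, b), h⟩ ↔ (openGraph ω).Reachable a b := by
  simp only [EndsJoined, Sym2.mem_iff]
  constructor
  · intro H
    exact H a (Or.inl rfl) b (Or.inr rfl)
  · rintro H x (rfl | rfl) y (rfl | rfl)
    exacts [.refl _, H, H.symm, .refl _]

theorem EndsJoined.mono {ω ω' : Config d} (h : ω ≤ ω') {e : Bond d} (he : EndsJoined ω e) :
    EndsJoined ω' e := fun x hx y hy => (he x hx y hy).mono (openGraph_mono h)

section Update

open Classical in
theorem le_update_true (ω : Config d) (e : Bond d) : ω ≤ Function.update ω e true := by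
  intro f
  by_cases h : f = e
  · subst h; simp [Bool.le_true]
  · simp [h]

-- A path can be shortened to cross the new bond at most once: not at all, or once in either
-- direction.
open Classical in
theorem reachable_update {ω : Config d} {a b : Fin d → ℤ} {h : s(a, b) ∈ (lattice d).edgeSet}
    {u v : Fin d → ℤ} (huv : (openGraph (Function.update ω ⟨s(a, b), h⟩ true)).Reachable u v) :
    (openGraph ω).Reachable u v ∨
      ((openGraph ω).Reachable u a ∧ (openGraph ω).Reachable b v) ∨
      ((openGraph ω).Reachable u b ∧ (openGraph ω).Reachable a v) := by
  rw [SimpleGraph.reachable_iff_reflTransGen] at huv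
  induction huv with
  | refl => exact Or.inl (.refl _)
  | @tail v w _ hvw ih =>
    obtain ⟨hl, ho⟩ := openGraph_adj.1 hvw
    by_cases hs : s(v, w) = s(a, b)
    · rw [Sym2.eq_iff] at hs
      obtain ⟨rfl, rfl⟩ | ⟨rfl, rfl⟩ := hs
      · rcases ih with h1 | h1 | h1
        · exact Or.inr (Or.inl ⟨h1, .refl _⟩)
        · exact Or.inr (Or.inl ⟨h1.1, .refl _⟩)
        · exact Or.inl h1.1
      · rcases ih with h1 | h1 | h1
        · exact Or.inr (Or.inr ⟨h1, .refl _⟩)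
        · exact Or.inl h1.1
        · exact Or.inr (Or.inr ⟨h1.1, .refl _⟩)
    · have ho' : ω ⟨s(v, w), hl⟩ = true := by
        rwa [Function.update_of_ne (by simpa [Subtype.ext_iff] using hs)] at ho
      have hr : (openGraph ω).Reachable v w := (openGraph_adj.2 ⟨hl, ho'⟩).reachable
      rcases ih with h1 | h1 | h1
      · exact Or.inl (h1.trans hr)
      · exact Or.inr (Or.inl ⟨h1.1, h1.2.trans hr⟩)
      · exact Or.inr (Or.inr ⟨h1.1, h1.2.trans hr⟩)

/-- The open clusters of `ω` that contain an end point of a bond of `E`. -/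
def clusters (E : Finset (Bond d)) (ω : Config d) : Set (openGraph ω).ConnectedComponent :=
  {c | ∃ e ∈ E, ∃ x ∈ (e : Sym2 (Fin d → ℤ)), (openGraph ω).connectedComponentMk x = c}

theorem clusters_finite (E : Finset (Bond d)) (ω : Config d) : (clusters E ω).Finite := by
  have : clusters E ω = ⋃ e ∈ (E : Set (Bond d)),
      (openGraph ω).connectedComponentMk '' {x | x ∈ (e : Sym2 (Fin d → ℤ))} := by
    ext c; simp [clusters]
  rw [this]
  refine E.finite_toSet.biUnion fun e _ => Set.Finite.image _ ?_
  induction e using Subtype.rec with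
  | _ e _ =>
    induction e using Sym2.ind with
    | _ a b => exact (Set.toFinite {a, b}).subset fun x hx => by simpa using hx

-- Opening `e` induces a surjection between the sets of counted clusters. It is injective if the
-- ends were already joined; otherwise it merges exactly the two clusters of the ends.
open Classical in
theorem clusterCount_update {E : Finset (Bond d)} {ω : Config d} {e : Bond d} (he : e ∈ E)
    (hω : ω e = false) :
    clusterCount E ω =
      clusterCount E (Function.update ω e true) + if EndsJoined ω e then 0 else 1 := by
  obtain ⟨s, hs⟩ := e
  induction s using Sym2.ind with
  | _ a b =>
  set ω' := Function.update ω ⟨s(a, b), hs⟩ true with hω'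
  have hle : openGraph ω ≤ openGraph ω' := openGraph_mono (le_update_true _ _)
  have hab : (openGraph ω').Reachable a b :=
    (openGraph_adj.2 ⟨hs, by simp [hω']⟩ : (openGraph ω').Adj a b).reachable
  let f : (openGraph ω).ConnectedComponent → (openGraph ω').ConnectedComponent :=
    SimpleGraph.ConnectedComponent.map (SimpleGraph.Hom.ofLE hle)
  have hf : ∀ x, f ((openGraph ω).connectedComponentMk x) = (openGraph ω').connectedComponentMk x :=
    fun x => rfl
  have himg : f '' clusters E ω = clusters E ω' := by
    ext c
    constructor
    · rintro ⟨_, ⟨e, he, x, hx, rfl⟩, rfl⟩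
      exact ⟨e, he, x, hx, rfl⟩
    · rintro ⟨e, he, x, hx, rfl⟩
      exact ⟨_, ⟨e, he, x, hx, rfl⟩, rfl⟩
  change (clusters E ω).ncard = (clusters E ω').ncard + _
  rw [endsJoined_mk]
  split_ifs with hj
  · rw [← himg, Set.InjOn.ncard_image, add_zero]
    intro c _ c' _
    induction c using SimpleGraph.ConnectedComponent.ind with | _ u
    induction c' using SimpleGraph.ConnectedComponent.ind with | _ v
    rw [hf, hf, SimpleGraph.ConnectedComponent.eq, SimpleGraph.ConnectedComponent.eq]
    intro huv
    rcases reachable_update huv with h | h | h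
    · exact h
    · exact h.1.trans (hj.trans h.2)
    · exact h.1.trans (hj.symm.trans h.2)
  · have hb : (openGraph ω).connectedComponentMk b ∈ clusters E ω :=
      ⟨_, he, b, by simp, rfl⟩
    have ha : (openGraph ω).connectedComponentMk a ∈ clusters E ω :=
      ⟨_, he, a, by simp, rfl⟩
    have himg' : f '' (clusters E ω \ {(openGraph ω).connectedComponentMk b}) = clusters E ω' := by
      rw [← himg]
      refine (Set.image_mono Set.sdiff_subset).antisymm ?_
      rintro _ ⟨c, hc, rfl⟩
      by_cases hcb : c = (openGraph ω).connectedComponentMk b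
      · refine ⟨(openGraph ω).connectedComponentMk a, ⟨ha, ?_⟩, ?_⟩
        · rw [Set.mem_singleton_iff, SimpleGraph.ConnectedComponent.eq]
          exact hj
        · rw [hcb, hf, hf, SimpleGraph.ConnectedComponent.eq]
          exact hab
      · exact ⟨c, ⟨hc, hcb⟩, rfl⟩
    rw [← himg', Set.InjOn.ncard_image,
      Set.ncard_sdiff_singleton_add_one hb (clusters_finite E ω)]
    rintro c ⟨_, hc⟩ c' ⟨_, hc'⟩
    induction c using SimpleGraph.ConnectedComponent.ind with | _ u
    induction c' using SimpleGraph.ConnectedComponent.ind with | _ v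
    rw [Set.mem_singleton_iff, SimpleGraph.ConnectedComponent.eq] at hc hc'
    rw [hf, hf, SimpleGraph.ConnectedComponent.eq, SimpleGraph.ConnectedComponent.eq]
    intro huv
    rcases reachable_update huv with h | h | h
    · exact h
    · exact absurd h.2.symm hc'
    · exact absurd h.1 hc

end Update

/-! ### Comparing cluster counts under two boundary conditions. -/

open Classical in
/-- The configuration obtained from `ω` by opening the bonds of `S`. -/
noncomputable def opened (S : Finset (Bond d)) (ω : Config d) : Config d :=
  fun e => if e ∈ S then true else ω e

open Classical in
theorem opened_insert (S : Finset (Bond d)) (e : Bond d) (ω : Config d) :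
    opened (insert e S) ω = Function.update (opened S ω) e true := by
  ext f
  by_cases h : f = e
  · subst h; simp [opened]
  · simp [opened, h]

theorem opened_empty (ω : Config d) : opened ∅ ω = ω := by
  ext f
  simp [opened]

/-- Open the bonds of `S` one at a time: a cluster is lost exactly when the ends are not yet joined,
and by `H` every loss for `ω₂` is also a loss for `ω₁`. Two volumes are allowed so that a volume can
later be compared with a subvolume. -/
theorem clusterCount_opened_add_le {E₁ E₂ S : Finset (Bond d)} (h₁ : S ⊆ E₁) (h₂ : S ⊆ E₂)
    {ω₁ ω₂ : Config d} (hω₁ : ∀ e ∈ S, ω₁ e = false) (hω₂ : ∀ e ∈ S, ω₂ e = false)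
    (H : ∀ T ⊆ S, ∀ e ∈ S, EndsJoined (opened T ω₁) e → EndsJoined (opened T ω₂) e) :
    clusterCount E₁ (opened S ω₁) + clusterCount E₂ ω₂ ≤
      clusterCount E₁ ω₁ + clusterCount E₂ (opened S ω₂) := by
  classical
  induction S using Finset.induction_on with
  | empty => simp [opened_empty]
  | insert e S heS ih =>
    have ih' := ih (fun x hx => h₁ (Finset.mem_insert_of_mem hx))
      (fun x hx => h₂ (Finset.mem_insert_of_mem hx))
      (fun x hx => hω₁ x (Finset.mem_insert_of_mem hx))
      (fun x hx => hω₂ x (Finset.mem_insert_of_mem hx))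
      (fun T hT x hx => H T (hT.trans (Finset.subset_insert _ _)) x (Finset.mem_insert_of_mem hx))
    have c₁ := clusterCount_update (h₁ (Finset.mem_insert_self e S)) (ω := opened S ω₁)
      (by simp [opened, heS, hω₁])
    have c₂ := clusterCount_update (h₂ (Finset.mem_insert_self e S)) (ω := opened S ω₂)
      (by simp [opened, heS, hω₂])
    have hH := H S (Finset.subset_insert _ _) e (Finset.mem_insert_self e S)
    rw [opened_insert, opened_insert]
    by_cases hj : EndsJoined (opened S ω₁) e
    · rw [if_pos hj] at c₁
      rw [if_pos (hH hj)] at c₂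
      omega
    · rw [if_neg hj] at c₁
      split_ifs at c₂ <;> omega

theorem glue_eq_opened (F : Finset (Bond d)) (ζ : F → Bool) (η : Config d) :
    glue F ζ η = opened ((Finset.univ.filter fun e => ζ e = true).map
      (Function.Embedding.subtype _)) (glue F (fun _ => false) η) := by
  ext f
  by_cases hf : f ∈ F
  · by_cases hz : ζ ⟨f, hf⟩ = true <;> simp [glue, opened, hf, hz]
  · simp [glue, opened, hf]

theorem glue_apply_mem {F : Finset (Bond d)} {e : Bond d} (he : e ∈ F) (ζ : F → Bool)
    (η : Config d) : glue F ζ η e = ζ ⟨e, he⟩ := by simp [glue, he]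

theorem glue_apply_notMem {F : Finset (Bond d)} {e : Bond d} (he : e ∉ F) (ζ : F → Bool)
    (η : Config d) : glue F ζ η e = η e := by simp [glue, he]

theorem opened_glue_false {F T : Finset (Bond d)} (hT : T ⊆ F) (η : Config d) :
    opened T (glue F (fun _ => false) η) = glue F (fun e => decide ((e : Bond d) ∈ T)) η := by
  ext f
  by_cases hf : f ∈ F
  · by_cases hz : f ∈ T <;> simp [glue, opened, hf, hz]
  · have : f ∉ T := fun h => hf (hT h)
    simp [glue, opened, hf, this]

/-- If both boundary conditions create the same connections, the two counts, as functions of the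
states on `F`, differ by a constant. -/
theorem clusterCount_glue_exchange {E₁ E₂ F : Finset (Bond d)} (h₁ : F ⊆ E₁) (h₂ : F ⊆ E₂)
    {η₁ η₂ : Config d}
    (H : ∀ ζ : F → Bool, ∀ e ∈ F,
      EndsJoined (glue F ζ η₁) e ↔ EndsJoined (glue F ζ η₂) e) (ζ ζ' : F → Bool) :
    clusterCount E₁ (glue F ζ η₁) + clusterCount E₂ (glue F ζ' η₂) =
      clusterCount E₁ (glue F ζ' η₁) + clusterCount E₂ (glue F ζ η₂) := by
  have key : ∀ ζ : F → Bool,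
      clusterCount E₁ (glue F ζ η₁) + clusterCount E₂ (glue F (fun _ => false) η₂) =
      clusterCount E₁ (glue F (fun _ => false) η₁) + clusterCount E₂ (glue F ζ η₂) := by
    intro ζ
    rw [glue_eq_opened F ζ η₁, glue_eq_opened F ζ η₂]
    set S := (Finset.univ.filter fun e => ζ e = true).map (Function.Embedding.subtype (· ∈ F))
    have hS : S ⊆ F := by
      intro e he
      simp only [S, Finset.mem_map] at he
      obtain ⟨a, _, rfl⟩ := he
      exact a.2
    have hfalse : ∀ η : Config d, ∀ e ∈ S, glue F (fun _ => false) η e = false := by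
      intro η e he
      rw [glue_apply_mem (hS he)]
    have HT : ∀ T ⊆ S, ∀ e ∈ S, EndsJoined (opened T (glue F (fun _ => false) η₁)) e ↔
        EndsJoined (opened T (glue F (fun _ => false) η₂)) e := by
      intro T hT e he
      rw [opened_glue_false (hT.trans hS), opened_glue_false (hT.trans hS)]
      exact H _ e (hS he)
    have i₁ := clusterCount_opened_add_le (hS.trans h₁) (hS.trans h₂) (hfalse η₁) (hfalse η₂)
      (fun T hT e he => (HT T hT e he).1)
    have i₂ := clusterCount_opened_add_le (hS.trans h₂) (hS.trans h₁) (hfalse η₂) (hfalse η₁)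
      (fun T hT e he => (HT T hT e he).2)
    omega
  have k := key ζ
  have k' := key ζ'
  omega

/-! ### Weights and their exchange identity. -/

theorem weight_nonneg (hp : 0 < p) (hp1 : p ≤ 1) (hq : 1 ≤ q) (E : Finset (Bond d))
    (ω : Config d) : 0 ≤ weight p q E ω := by
  refine mul_nonneg (Finset.prod_nonneg fun e _ => ?_) (by positivity)
  split_ifs <;> linarith

theorem partitionFunction_pos (hp : 0 < p) (hp1 : p ≤ 1) (hq : 1 ≤ q) (E : Finset (Bond d))
    (η : Config d) : 0 < partitionFunction p q E η := by
  -- The all-open configuration has positive weight even when p = 1.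
  refine Finset.sum_pos' (fun ζ _ => weight_nonneg hp hp1 hq _ _)
    ⟨fun _ => true, Finset.mem_univ _, ?_⟩
  refine mul_pos (Finset.prod_pos fun e he => ?_) (by positivity)
  rw [if_pos (glue_apply_mem he _ _)]
  exact hp

theorem prod_glue (g : Bool → ℝ) {E F : Finset (Bond d)} (h : F ⊆ E) (η : Config d) :
    ∃ c : ℝ, (∀ ζ : F → Bool, ∏ e ∈ E, g (glue F ζ η e) = (∏ e, g (ζ e)) * c) := by
  classical
  refine ⟨∏ e ∈ E \ F, g (η e), fun ζ => ?_⟩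
  rw [← Finset.prod_sdiff h, mul_comm]
  congr 1
  · rw [← Finset.prod_attach]
    exact Finset.prod_congr rfl fun e _ => by rw [glue_apply_mem e.2]
  · exact Finset.prod_congr rfl fun e he => by
      rw [glue_apply_notMem (Finset.mem_sdiff.1 he).2]

/-- The product form says that ratios of weights agree, without dividing by weights that may vanish
when p = 1. -/
theorem weight_glue_exchange {E₁ E₂ F : Finset (Bond d)} (h₁ : F ⊆ E₁) (h₂ : F ⊆ E₂)
    {η₁ η₂ : Config d}
    (H : ∀ ζ : F → Bool, ∀ e ∈ F,
      EndsJoined (glue F ζ η₁) e ↔ EndsJoined (glue F ζ η₂) e) (ζ ζ' : F → Bool) :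
    weight p q E₁ (glue F ζ η₁) * weight p q E₂ (glue F ζ' η₂) =
      weight p q E₁ (glue F ζ' η₁) * weight p q E₂ (glue F ζ η₂) := by
  obtain ⟨c₁, hc₁⟩ := prod_glue (fun b => if b = true then p else 1 - p) h₁ η₁
  obtain ⟨c₂, hc₂⟩ := prod_glue (fun b => if b = true then p else 1 - p) h₂ η₂
  have hk := clusterCount_glue_exchange h₁ h₂ H ζ ζ'
  have hq : q ^ clusterCount E₁ (glue F ζ η₁) * q ^ clusterCount E₂ (glue F ζ' η₂) =
      q ^ clusterCount E₁ (glue F ζ' η₁) * q ^ clusterCount E₂ (glue F ζ η₂) := by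
    rw [← pow_add, ← pow_add, hk]
  simp only [weight, hc₁, hc₂]
  linear_combination ((∏ e, if ζ e = true then p else 1 - p) * c₁ *
    (∏ e, if ζ' e = true then p else 1 - p) * c₂) * hq

theorem glue_glue_self (F : Finset (Bond d)) (ζ ξ : F → Bool) (η : Config d) :
    glue F ζ (glue F ξ η) = glue F ζ η := by
  ext e
  by_cases he : e ∈ F <;> simp [glue, he]

theorem glue_restrict (F : Finset (Bond d)) (ω : Config d) : glue F (fun e => ω e) ω = ω := by
  ext e
  by_cases he : e ∈ F <;> simp [glue, he]

/-! ### Finite-volume expectations and the spatial Markov property. -/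

/-- The expectation of `f` under the finite-volume random-cluster measure. -/
noncomputable def expect (p q : ℝ) (E : Finset (Bond d)) (η : Config d) (f : Config d → ℝ) : ℝ :=
  (∑ ζ : E → Bool, weight p q E (glue E ζ η) * f (glue E ζ η)) / partitionFunction p q E η

theorem expect_mono (hp : 0 < p) (hp1 : p ≤ 1) (hq : 1 ≤ q) {E : Finset (Bond d)} {η : Config d}
    {f g : Config d → ℝ} (h : ∀ ζ, f (glue E ζ η) ≤ g (glue E ζ η)) :
    expect p q E η f ≤ expect p q E η g := by
  refine div_le_div_of_nonneg_right (Finset.sum_le_sum fun ζ _ => ?_)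
    (partitionFunction_pos hp hp1 hq E η).le
  exact mul_le_mul_of_nonneg_left (h ζ) (weight_nonneg hp hp1 hq _ _)

theorem expect_congr {E : Finset (Bond d)} {η : Config d}
    {f g : Config d → ℝ} (h : ∀ ζ, f (glue E ζ η) = g (glue E ζ η)) :
    expect p q E η f = expect p q E η g := by
  simp only [expect, h]

theorem expect_const (hp : 0 < p) (hp1 : p ≤ 1) (hq : 1 ≤ q) (E : Finset (Bond d)) (η : Config d)
    (c : ℝ) : expect p q E η (fun _ => c) = c := by
  rw [expect, ← Finset.sum_mul]
  exact mul_div_cancel_left₀ _ (partitionFunction_pos hp hp1 hq E η).ne'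

theorem expect_const_mul (E : Finset (Bond d)) (η : Config d) (c : ℝ) (f : Config d → ℝ) :
    expect p q E η (fun ω => c * f ω) = c * expect p q E η f := by
  rw [expect, expect, ← mul_div_assoc, Finset.mul_sum]
  congr 1
  exact Finset.sum_congr rfl fun ζ _ => by ring

theorem expect_mul_const (E : Finset (Bond d)) (η : Config d) (c : ℝ) (f : Config d → ℝ) :
    expect p q E η (fun ω => f ω * c) = expect p q E η f * c := by
  simp_rw [mul_comm _ c]
  exact expect_const_mul E η c f

theorem expect_sub (E : Finset (Bond d)) (η : Config d) (f g : Config d → ℝ) :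
    expect p q E η (fun ω => f ω - g ω) = expect p q E η f - expect p q E η g := by
  simp only [expect, mul_sub, Finset.sum_sub_distrib, sub_div]

theorem expect_sum {ι : Type*} (s : Finset ι) (E : Finset (Bond d)) (η : Config d)
    (f : ι → Config d → ℝ) :
    expect p q E η (fun ω => ∑ i ∈ s, f i ω) = ∑ i ∈ s, expect p q E η (f i) := by
  simp only [expect, Finset.mul_sum]
  rw [Finset.sum_comm, Finset.sum_div]

open Classical in
/-- The overwriting of `ζ` by `ξ` on `F`. -/
noncomputable def overwrite {E F : Finset (Bond d)} (ζ : E → Bool) (ξ : F → Bool) : E → Bool :=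
  fun e => if h : (e : Bond d) ∈ F then ξ ⟨e, h⟩ else ζ e

theorem glue_overwrite {E F : Finset (Bond d)} (h : F ⊆ E) (ζ : E → Bool) (ξ : F → Bool)
    (η : Config d) : glue E (overwrite ζ ξ) η = glue F ξ (glue E ζ η) := by
  ext e
  by_cases he : e ∈ E <;> by_cases hf : e ∈ F
  · simp [glue, overwrite, he, hf]
  · simp [glue, overwrite, he, hf]
  · exact absurd (h hf) he
  · simp [glue, he, hf]

/-- Swapping `ξ` with the restriction of `ζ` to `F` is an involution on pairs. This is the change of
variables behind `expect_expect`. -/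
theorem sum_overwrite_comm {E F : Finset (Bond d)} (h : F ⊆ E)
    (f : (E → Bool) → (F → Bool) → ℝ) :
    ∑ ζ, ∑ ξ, f ζ ξ = ∑ ζ : E → Bool, ∑ ξ : F → Bool,
      f (overwrite ζ ξ) (fun e => ζ ⟨e, h e.2⟩) := by
  rw [← Fintype.sum_prod_type', ← Fintype.sum_prod_type'
    (fun (ζ : E → Bool) (ξ : F → Bool) => f (overwrite ζ ξ) (fun e => ζ ⟨e, h e.2⟩))]
  have hinv : Function.Involutive (fun x : (E → Bool) × (F → Bool) =>
      ((overwrite x.1 x.2, fun e : F => x.1 ⟨e, h e.2⟩) : (E → Bool) × (F → Bool))) := by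
    rintro ⟨ζ, ξ⟩
    ext e
    · by_cases he : (e : Bond d) ∈ F <;> simp [overwrite, he]
    · simp [overwrite]
  exact (Equiv.sum_comp (hinv.toPerm _) (fun x => f x.1 x.2)).symm

/-- The spatial Markov property of finite-volume random-cluster measures. -/
theorem expect_expect (hp : 0 < p) (hp1 : p ≤ 1) (hq : 1 ≤ q) {E F : Finset (Bond d)}
    (h : F ⊆ E) (η : Config d) (f : Config d → ℝ) :
    expect p q E η (fun ω => expect p q F ω f) = expect p q E η f := by
  have hZ : ∀ (ζ : E → Bool) (ξ : F → Bool),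
      partitionFunction p q F (glue F ξ (glue E ζ η)) =
        partitionFunction p q F (glue E ζ η) := by
    intro ζ ξ
    simp only [partitionFunction, glue_glue_self]
  have hg : ∀ ζ : E → Bool, glue F (fun e => ζ ⟨e, h e.2⟩) (glue E ζ η) = glue E ζ η := by
    intro ζ
    conv_rhs => rw [← glue_restrict F (glue E ζ η)]
    congr 1
    ext e
    rw [glue_apply_mem (h e.2)]
  rw [expect, expect]
  congr 1
  calc ∑ ζ : E → Bool, weight p q E (glue E ζ η) * expect p q F (glue E ζ η) f
      = ∑ ζ : E → Bool, ∑ ξ : F → Bool, weight p q E (glue E ζ η) *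
          weight p q F (glue F ξ (glue E ζ η)) * f (glue F ξ (glue E ζ η)) /
            partitionFunction p q F (glue E ζ η) := by
        refine Finset.sum_congr rfl fun ζ _ => ?_
        rw [expect, ← mul_div_assoc, Finset.mul_sum, Finset.sum_div]
        exact Finset.sum_congr rfl fun ξ _ => by rw [mul_assoc]
    _ = ∑ ζ : E → Bool, ∑ ξ : F → Bool, weight p q E (glue E ζ η) *
          weight p q F (glue F ξ (glue E ζ η)) * f (glue E ζ η) /
            partitionFunction p q F (glue E ζ η) := by
        -- After the swap `f` is evaluated at the original configuration, and the exchange identity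
        -- restores the product of weights.
        rw [sum_overwrite_comm h]
        refine Finset.sum_congr rfl fun ζ _ => Finset.sum_congr rfl fun ξ _ => ?_
        rw [glue_overwrite h, hZ, glue_glue_self, hg]
        congr 2
        have := weight_glue_exchange (p := p) (q := q) h subset_rfl (η₁ := glue E ζ η)
          (η₂ := glue E ζ η) (fun _ _ _ => Iff.rfl) ξ (fun e => ζ ⟨e, h e.2⟩)
        rwa [hg] at this
    _ = ∑ ζ : E → Bool, weight p q E (glue E ζ η) * f (glue E ζ η) := by
        refine Finset.sum_congr rfl fun ζ _ => ?_
        have hpos := (partitionFunction_pos hp hp1 hq F (glue E ζ η)).ne'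
        rw [← Finset.sum_div, ← Finset.sum_mul, ← Finset.mul_sum]
        rw [div_eq_iff hpos, partitionFunction]
        ring

/-- A boundary condition influences `F` only through the connections it creates between ends of
bonds of `F`. -/
theorem expect_eq_of_endsJoined_iff (hp : 0 < p) (hp1 : p ≤ 1) (hq : 1 ≤ q)
    {F : Finset (Bond d)} {η₁ η₂ : Config d}
    (H : ∀ ζ : F → Bool, ∀ e ∈ F,
      EndsJoined (glue F ζ η₁) e ↔ EndsJoined (glue F ζ η₂) e)
    {f : Config d → ℝ} (hf : ∀ ζ, f (glue F ζ η₁) = f (glue F ζ η₂)) :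
    expect p q F η₁ f = expect p q F η₂ f := by
  rw [expect, expect, div_eq_div_iff (partitionFunction_pos hp hp1 hq _ _).ne'
    (partitionFunction_pos hp hp1 hq _ _).ne', partitionFunction, partitionFunction,
    Finset.sum_mul_sum, Finset.sum_mul_sum, Finset.sum_comm]
  conv_rhs => rw [Finset.sum_comm]
  rw [Finset.sum_comm]
  conv_rhs => rw [Finset.sum_comm]
  refine Finset.sum_congr rfl fun ζ _ => Finset.sum_congr rfl fun ζ' _ => ?_
  have := weight_glue_exchange (p := p) (q := q) subset_rfl subset_rfl H ζ ζ'
  rw [hf]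
  linear_combination f (glue F ζ η₂) * this

/-! ### Stochastic monotonicity and finite energy. -/

/-- This is Holley's condition. Opening the bonds `S` that are open in `ζ` and closed in `ζ'` turns
the meet into `ζ`, and `ζ'` into the join. Connections grow with the configuration, so the second
operation loses no more clusters than the first; q ≥ 1 turns this into an inequality of weights. -/
theorem weight_glue_mul_le (hp : 0 < p) (hp1 : p ≤ 1) (hq : 1 ≤ q) (E : Finset (Bond d))
    {η η' : Config d} (h : η ≤ η') (ζ ζ' : E → Bool) :
    weight p q E (glue E ζ η) * weight p q E (glue E ζ' η') ≤
      weight p q E (glue E (ζ ⊓ ζ') η) * weight p q E (glue E (ζ ⊔ ζ') η') := by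
  classical
  obtain ⟨c, hc⟩ := prod_glue (fun b => if b = true then p else 1 - p) (Finset.Subset.refl E) η
  obtain ⟨c', hc'⟩ := prod_glue (fun b => if b = true then p else 1 - p) (Finset.Subset.refl E) η'
  set S : Finset (Bond d) := (Finset.univ.filter fun e : E => ζ e = true ∧ ζ' e = false).map
    (Function.Embedding.subtype _) with hS
  have hSE : S ⊆ E := by
    intro e he
    simp only [S, Finset.mem_map] at he
    obtain ⟨a, _, rfl⟩ := he
    exact a.2
  have hmem : ∀ e (he : e ∈ E), e ∈ S ↔ ζ ⟨e, he⟩ = true ∧ ζ' ⟨e, he⟩ = false := by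
    intro e he
    simp [hS, he]
  have hnot : ∀ e, e ∉ E → e ∉ S := fun e he h => he (hSE h)
  have e₁ : glue E ζ η = opened S (glue E (ζ ⊓ ζ') η) := by
    ext e
    by_cases he : e ∈ E
    · simp only [opened, glue, he, hmem e he, dif_pos, Pi.inf_apply]
      cases ζ ⟨e, he⟩ <;> cases ζ' ⟨e, he⟩ <;> simp
    · simp [opened, glue, he, hnot e he]
  have e₂ : glue E (ζ ⊔ ζ') η' = opened S (glue E ζ' η') := by
    ext e
    by_cases he : e ∈ E
    · simp only [opened, glue, he, hmem e he, dif_pos, Pi.sup_apply]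
      cases ζ ⟨e, he⟩ <;> cases ζ' ⟨e, he⟩ <;> simp
    · simp [opened, glue, he, hnot e he]
  have hle : ∀ T : Finset (Bond d),
      opened T (glue E (ζ ⊓ ζ') η) ≤ opened T (glue E ζ' η') := by
    intro T e
    by_cases hT : e ∈ T
    · simp [opened, hT]
    · by_cases he : e ∈ E
      · simp only [opened, glue, he, hT, dif_pos, if_false, Pi.inf_apply]
        exact inf_le_right
      · simpa only [opened, glue, he, hT, dif_neg, if_false, not_false_iff] using h e
  have hk := clusterCount_opened_add_le hSE hSE (ω₁ := glue E (ζ ⊓ ζ') η) (ω₂ := glue E ζ' η')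
    (fun e he => by
      have := (hmem e (hSE he)).1 he
      rw [glue_apply_mem (hSE he), Pi.inf_apply, this.2]
      simp)
    (fun e he => by
      have := (hmem e (hSE he)).1 he
      rw [glue_apply_mem (hSE he), this.2])
    (fun T _ e _ => EndsJoined.mono (hle T))
  rw [← e₁, ← e₂] at hk
  have hq' : q ^ clusterCount E (glue E ζ η) * q ^ clusterCount E (glue E ζ' η') ≤
      q ^ clusterCount E (glue E (ζ ⊓ ζ') η) * q ^ clusterCount E (glue E (ζ ⊔ ζ') η') := by
    rw [← pow_add, ← pow_add]
    exact pow_le_pow_right₀ hq hk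
  have hprod : (∏ e : E, if ζ e = true then p else 1 - p) *
      (∏ e : E, if ζ' e = true then p else 1 - p) =
      (∏ e : E, if (ζ ⊓ ζ') e = true then p else 1 - p) *
      (∏ e : E, if (ζ ⊔ ζ') e = true then p else 1 - p) := by
    rw [← Finset.prod_mul_distrib, ← Finset.prod_mul_distrib]
    refine Finset.prod_congr rfl fun e _ => ?_
    simp only [Pi.inf_apply, Pi.sup_apply]
    rcases Bool.eq_false_or_eq_true (ζ e) with h₁ | h₁ <;>
      rcases Bool.eq_false_or_eq_true (ζ' e) with h₂ | h₂ <;> simp [h₁, h₂, mul_comm]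
  have hnn : ∀ ω : Config d, 0 ≤ ∏ e ∈ E, if ω e = true then p else 1 - p :=
    fun ω => Finset.prod_nonneg fun e _ => by split_ifs <;> linarith
  calc weight p q E (glue E ζ η) * weight p q E (glue E ζ' η')
      = ((∏ e ∈ E, if glue E ζ η e = true then p else 1 - p) *
        (∏ e ∈ E, if glue E ζ' η' e = true then p else 1 - p)) *
        (q ^ clusterCount E (glue E ζ η) * q ^ clusterCount E (glue E ζ' η')) := by
        simp only [weight]; ring
    _ ≤ ((∏ e ∈ E, if glue E ζ η e = true then p else 1 - p) *
        (∏ e ∈ E, if glue E ζ' η' e = true then p else 1 - p)) *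
        (q ^ clusterCount E (glue E (ζ ⊓ ζ') η) * q ^ clusterCount E (glue E (ζ ⊔ ζ') η')) :=
        mul_le_mul_of_nonneg_left hq' (mul_nonneg (hnn _) (hnn _))
    _ = _ := by
        simp only [weight, hc, hc']
        linear_combination (c * c' * (q ^ clusterCount E (glue E (ζ ⊓ ζ') η) *
          q ^ clusterCount E (glue E (ζ ⊔ ζ') η'))) * hprod

theorem glue_mono {E : Finset (Bond d)} {ζ ζ' : E → Bool} (hζ : ζ ≤ ζ') {η η' : Config d}
    (hη : η ≤ η') : glue E ζ η ≤ glue E ζ' η' := by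
  intro e
  by_cases he : e ∈ E
  · simpa [glue, he] using hζ ⟨e, he⟩
  · simpa [glue, he] using hη e

/-- The random-cluster measure with `q ≥ 1` is stochastically increasing in the boundary
condition. -/
theorem expect_mono_boundary (hp : 0 < p) (hp1 : p ≤ 1) (hq : 1 ≤ q) (E : Finset (Bond d))
    {η η' : Config d} (h : η ≤ η') {f : Config d → ℝ} (hf0 : 0 ≤ f) (hf : Monotone f) :
    expect p q E η f ≤ expect p q E η' f := by
  have hZ := partitionFunction_pos hp hp1 hq E η
  have hZ' := partitionFunction_pos hp hp1 hq E η'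
  have hol := holley (μ := fun ζ : E → Bool => f (glue E ζ η))
    (f := fun ζ => weight p q E (glue E ζ η) / partitionFunction p q E η)
    (g := fun ζ => weight p q E (glue E ζ η') / partitionFunction p q E η')
    (fun ζ => hf0 _)
    (fun ζ => div_nonneg (weight_nonneg hp hp1 hq _ _) hZ.le)
    (fun ζ => div_nonneg (weight_nonneg hp hp1 hq _ _) hZ'.le)
    (fun ζ ζ' hζ => hf (glue_mono hζ le_rfl))
    (by
      rw [← Finset.sum_div, ← Finset.sum_div]
      exact (div_self hZ.ne').trans (div_self hZ'.ne').symm)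
    (fun ζ ζ' => by
      rw [div_mul_div_comm, div_mul_div_comm]
      exact div_le_div_of_nonneg_right (weight_glue_mul_le hp hp1 hq E h ζ ζ')
        (mul_pos hZ hZ').le)
  calc expect p q E η f
      = ∑ ζ : E → Bool, f (glue E ζ η) *
          (weight p q E (glue E ζ η) / partitionFunction p q E η) := by
        rw [expect, Finset.sum_div]
        exact Finset.sum_congr rfl fun ζ _ => by ring
    _ ≤ ∑ ζ : E → Bool, f (glue E ζ η) *
          (weight p q E (glue E ζ η') / partitionFunction p q E η') := hol
    _ ≤ ∑ ζ : E → Bool, f (glue E ζ η') *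
          (weight p q E (glue E ζ η') / partitionFunction p q E η') :=
        Finset.sum_le_sum fun ζ _ => mul_le_mul_of_nonneg_right (hf (glue_mono le_rfl h))
          (div_nonneg (weight_nonneg hp hp1 hq _ _) hZ'.le)
    _ = expect p q E η' f := by
        rw [expect, Finset.sum_div]
        exact Finset.sum_congr rfl fun ζ _ => by ring

-- Opening a bond destroys at most one cluster, which costs at most a factor q.
open Classical in
theorem mul_weight_le_weight_update (hp : 0 < p) (hp1 : p ≤ 1) (hq : 1 ≤ q)
    {E : Finset (Bond d)} {ω : Config d} {e : Bond d} (he : e ∈ E) (hω : ω e = false) :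
    p * weight p q E ω ≤ q * (1 - p) * weight p q E (Function.update ω e true) := by
  have hk := clusterCount_update he hω
  have hk' : clusterCount E ω ≤ clusterCount E (Function.update ω e true) + 1 := by
    split_ifs at hk <;> omega
  have hprod : ∏ f ∈ E.erase e, (if Function.update ω e true f = true then p else 1 - p) =
      ∏ f ∈ E.erase e, (if ω f = true then p else 1 - p) :=
    Finset.prod_congr rfl fun f hf => by
      rw [Function.update_of_ne (Finset.ne_of_mem_erase hf)]
  rw [weight, weight, ← Finset.mul_prod_erase E _ he, ← Finset.mul_prod_erase E _ he, hprod]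
  simp only [hω, Function.update_self, if_true, Bool.false_eq_true, if_false]
  have hnn : 0 ≤ ∏ f ∈ E.erase e, (if ω f = true then p else 1 - p) :=
    Finset.prod_nonneg fun f _ => by split_ifs <;> linarith
  have := pow_le_pow_right₀ hq hk'
  rw [pow_succ] at this
  have hc : 0 ≤ p * (1 - p) * ∏ f ∈ E.erase e, (if ω f = true then p else 1 - p) :=
    mul_nonneg (mul_nonneg hp.le (by linarith)) hnn
  calc _ = (p * (1 - p) * ∏ f ∈ E.erase e, (if ω f = true then p else 1 - p)) *
        q ^ clusterCount E ω := by ring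
    _ ≤ _ := mul_le_mul_of_nonneg_left this hc
    _ = _ := by ring

-- Opening `e` maps the configurations closed on `insert e S` injectively into those closed on `S`;
-- each bond thus contributes a factor q(1-p)/p.
open Classical in
theorem expect_closed_le (hp : 0 < p) (hp1 : p ≤ 1) (hq : 1 ≤ q) {E S : Finset (Bond d)}
    (hS : S ⊆ E) (η : Config d) :
    expect p q E η (fun ω => if ∀ e ∈ S, ω e = false then 1 else 0) ≤
      (q * (1 - p) / p) ^ S.card := by
  induction S using Finset.induction_on with
  | empty => simp [expect_const hp hp1 hq]
  | insert e S heS ih =>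
    have heE : e ∈ E := hS (Finset.mem_insert_self e S)
    have ih' := ih fun x hx => hS (Finset.mem_insert_of_mem hx)
    have ht : 0 ≤ q * (1 - p) / p :=
      div_nonneg (mul_nonneg (by linarith) (by linarith)) hp.le
    rw [Finset.card_insert_of_notMem heS, pow_succ']
    refine le_trans ?_ (mul_le_mul_of_nonneg_left ih' ht)
    rw [expect, expect, ← mul_div_assoc]
    refine div_le_div_of_nonneg_right ?_ (partitionFunction_pos hp hp1 hq E η).le
    rw [div_mul_eq_mul_div, le_div_iff₀ hp, mul_comm _ p]
    simp only [mul_ite, mul_one, mul_zero, ← Finset.sum_filter]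
    rw [Finset.mul_sum, Finset.mul_sum]
    have hglue : ∀ ζ : E → Bool, glue E (Function.update ζ ⟨e, heE⟩ true) η =
        Function.update (glue E ζ η) e true := by
      intro ζ
      ext f
      by_cases hf : f = e
      · subst hf; simp [glue, heE]
      · by_cases hfE : f ∈ E <;> simp [glue, hfE, hf]
    have hinj : Set.InjOn (fun ζ : E → Bool => Function.update ζ ⟨e, heE⟩ true)
        (Finset.univ.filter fun ζ : E → Bool => ∀ f ∈ insert e S, glue E ζ η f = false) := by
      intro ζ hζ ζ' hζ' h
      have h₁ := (Finset.mem_filter.1 hζ).2 e (Finset.mem_insert_self e S)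
      have h₂ := (Finset.mem_filter.1 hζ').2 e (Finset.mem_insert_self e S)
      rw [glue_apply_mem heE] at h₁ h₂
      ext f
      by_cases hf : f = ⟨e, heE⟩
      · rw [hf, h₁, h₂]
      · have := congrFun h f
        simpa [hf] using this
    calc ∑ ζ ∈ Finset.univ.filter fun ζ : E → Bool => ∀ f ∈ insert e S, glue E ζ η f = false,
          p * weight p q E (glue E ζ η)
        ≤ ∑ ζ ∈ Finset.univ.filter fun ζ : E → Bool => ∀ f ∈ insert e S, glue E ζ η f = false,
          q * (1 - p) * weight p q E (glue E (Function.update ζ ⟨e, heE⟩ true) η) := by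
          refine Finset.sum_le_sum fun ζ hζ => ?_
          rw [hglue]
          exact mul_weight_le_weight_update hp hp1 hq heE
            ((Finset.mem_filter.1 hζ).2 e (Finset.mem_insert_self e S))
      _ = ∑ ζ ∈ (Finset.univ.filter fun ζ : E → Bool =>
            ∀ f ∈ insert e S, glue E ζ η f = false).image
              (fun ζ => Function.update ζ ⟨e, heE⟩ true),
          q * (1 - p) * weight p q E (glue E ζ η) := by
          rw [Finset.sum_image hinj]
      _ ≤ _ := by
          refine Finset.sum_le_sum_of_subset_of_nonneg ?_ fun ζ _ _ =>
            mul_nonneg (mul_nonneg (by linarith) (by linarith)) (weight_nonneg hp hp1 hq _ _)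
          intro ζ' hζ'
          obtain ⟨ζ, hζ, rfl⟩ := Finset.mem_image.1 hζ'
          refine Finset.mem_filter.2 ⟨Finset.mem_univ _, fun f hf => ?_⟩
          rw [hglue, Function.update_of_ne (ne_of_mem_of_not_mem hf heS)]
          exact (Finset.mem_filter.1 hζ).2 f (Finset.mem_insert_of_mem hf)

/-! ### Unit squares, exactness of closed cochains, and shielding. -/

/-- The neighbour of `x` in the positive `i`-th coordinate direction. -/
def shift (x : Fin d → ℤ) (i : Fin d) : Fin d → ℤ := x + Pi.single i 1

theorem shift_comm (x : Fin d → ℤ) (i j : Fin d) :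
    shift (shift x i) j = shift (shift x j) i := by
  simp only [shift]; abel

theorem l1Dist_shift (x : Fin d → ℤ) (i : Fin d) : l1Dist x (shift x i) = 1 := by
  simp only [l1Dist, shift, Pi.add_apply]
  rw [Finset.sum_eq_single i]
  · simp
  · intro j _ hj
    simp [Pi.single_eq_of_ne hj]
  · simp

theorem l1Dist_self (x : Fin d → ℤ) : l1Dist x x = 0 := by simp [l1Dist]

theorem l1Dist_comm (x y : Fin d → ℤ) : l1Dist x y = l1Dist y x :=
  Finset.sum_congr rfl fun i _ => by rw [← Int.natAbs_neg, neg_sub]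

theorem l1Dist_triangle (x y z : Fin d → ℤ) : l1Dist x z ≤ l1Dist x y + l1Dist y z := by
  simp only [l1Dist, ← Finset.sum_add_distrib]
  exact Finset.sum_le_sum fun i _ => by omega

theorem exists_shift_of_l1Dist {x y : Fin d → ℤ} (h : l1Dist x y = 1) :
    ∃ i, y = shift x i ∨ x = shift y i := by
  have hex : ∃ i, (x i - y i).natAbs ≠ 0 := by
    by_contra! hcon
    simp [l1Dist, hcon] at h
  obtain ⟨i, hi⟩ := hex
  rw [l1Dist, ← Finset.add_sum_erase _ _ (Finset.mem_univ i)] at h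
  have h0 : ∑ j ∈ Finset.univ.erase i, (x j - y j).natAbs = 0 := by omega
  have hj : ∀ j, j ≠ i → x j = y j := by
    intro j hj
    have := Finset.sum_eq_zero_iff.1 h0 j (Finset.mem_erase.2 ⟨hj, Finset.mem_univ _⟩)
    omega
  refine ⟨i, ?_⟩
  have h1 : y i = x i + 1 ∨ x i = y i + 1 := by omega
  refine h1.imp (fun h => ?_) (fun h => ?_)
  · ext j
    by_cases hji : j = i
    · subst hji; simp [shift, h]
    · simp [shift, Pi.single_eq_of_ne hji, hj j hji]
  · ext j
    by_cases hji : j = i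
    · subst hji; simp [shift, h]
    · simp [shift, Pi.single_eq_of_ne hji, hj j hji]

/-- The bond between `x` and its neighbour in the positive `i`-th coordinate direction. -/
def bond (x : Fin d → ℤ) (i : Fin d) : Bond d := ⟨s(x, shift x i), l1Dist_shift x i⟩

theorem exists_eq_bond (e : Bond d) : ∃ x i, e = bond x i := by
  obtain ⟨s, hs⟩ := e
  induction s using Sym2.ind with
  | _ a b =>
    obtain ⟨i, rfl | rfl⟩ := exists_shift_of_l1Dist (show l1Dist a b = 1 from hs)
    · exact ⟨a, i, rfl⟩
    · exact ⟨b, i, Subtype.ext Sym2.eq_swap⟩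

theorem mem_bond {x y : Fin d → ℤ} {i : Fin d} :
    y ∈ (bond x i : Sym2 (Fin d → ℤ)) ↔ y = x ∨ y = shift x i := by
  simp [bond]

/-- The four sides of the unit square with lowest corner `x` and directions `i`, `j`. -/
def square (x : Fin d → ℤ) (i j : Fin d) : Set (Bond d) :=
  {bond x i, bond x j, bond (shift x i) j, bond (shift x j) i}

/-- Two bonds are sides of a common unit square. -/
def SqAdj (e f : Bond d) : Prop := ∃ x i j, i ≠ j ∧ e ∈ square x i j ∧ f ∈ square x i j

theorem SqAdj.symm {e f : Bond d} (h : SqAdj e f) : SqAdj f e := by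
  obtain ⟨x, i, j, hij, he, hf⟩ := h
  exact ⟨x, i, j, hij, hf, he⟩

theorem exists_int_antidifference :
    ∃ S : (ℤ → ℤ) → ℤ → ℤ, ∀ g m, S g (m + 1) - S g m = g m := by
  refine ⟨fun g m => ∑ t ∈ Finset.Ico 0 m, g t - ∑ t ∈ Finset.Ico m 0, g t, fun g m => ?_⟩
  beta_reduce
  rcases le_or_gt 0 m with hm | hm
  · have h1 : Finset.Ico 0 (m + 1) = insert m (Finset.Ico 0 m) := by
      ext t; simp only [Finset.mem_Ico, Finset.mem_insert]; omega
    rw [h1, Finset.sum_insert (by simp), Finset.Ico_eq_empty (by omega : ¬ m + 1 < 0),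
      Finset.Ico_eq_empty (by omega : ¬ m < 0)]
    ring
  · have h1 : Finset.Ico m 0 = insert m (Finset.Ico (m + 1) 0) := by
      ext t; simp only [Finset.mem_Ico, Finset.mem_insert]; omega
    rw [h1, Finset.sum_insert (by simp), Finset.Ico_eq_empty (by omega : ¬ (0 : ℤ) < m + 1),
      Finset.Ico_eq_empty (by omega : ¬ (0 : ℤ) < m)]
    ring

/-- A `1`-cochain on `ℤ^d` that is closed on every unit square is exact. -/
theorem exists_potential (c : (Fin d → ℤ) → Fin d → ℤ)
    (hc : ∀ x i j, i ≠ j → c x i + c (shift x i) j = c x j + c (shift x j) i) :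
    ∃ w : (Fin d → ℤ) → ℤ, ∀ x i, w (shift x i) - w x = c x i := by
  obtain ⟨S, hS⟩ := exists_int_antidifference
  have key : ∀ k : ℕ, ∃ w : (Fin d → ℤ) → ℤ,
      ∀ x (i : Fin d), (i : ℕ) < k → w (shift x i) - w x = c x i := by
    intro k
    induction k with
    | zero => exact ⟨0, fun x i h => absurd h (Nat.not_lt_zero _)⟩
    | succ k ih =>
      obtain ⟨w, hw⟩ := ih
      by_cases hk : k < d
      · set l : Fin d := ⟨k, hk⟩ with hl
        -- `b` is the defect of `w` in direction `l`. Closedness makes it invariant under the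
        -- earlier directions, so adding its sum along direction `l` to `w` repairs this direction
        -- without spoiling the others.
        set b : (Fin d → ℤ) → ℤ := fun x => c x l - (w (shift x l) - w x) with hb
        have hinv : ∀ x (i : Fin d), (i : ℕ) < k → b (shift x i) = b x := by
          intro x i hi
          have hil : i ≠ l := by
            rintro rfl
            exact lt_irrefl _ hi
          have h1 := hc x i l hil
          have h2 := hw x i hi
          have h3 := hw (shift x l) i hi
          simp only [hb]
          rw [shift_comm x i l]
          linarith
        refine ⟨fun x => w x + S (fun t => b (Function.update x l t)) (x l), fun x i hi => ?_⟩
        rcases Nat.lt_succ_iff_lt_or_eq.1 hi with hik | hik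
        · have hil : l ≠ i := by
            rintro rfl
            exact lt_irrefl _ hik
          have h1 : (fun t => b (Function.update (shift x i) l t)) =
              fun t => b (Function.update x l t) := by
            ext t
            rw [← hinv (Function.update x l t) i hik]
            congr 1
            ext j
            by_cases hj : j = l
            · subst hj; simp [shift, Pi.single_eq_of_ne hil]
            · simp [shift, hj]
          have h2 : shift x i l = x l := by simp [shift, Pi.single_eq_of_ne hil]
          simp only [h1, h2]
          have := hw x i hik
          linarith
        · obtain rfl : i = l := Fin.ext hik
          have h1 : (fun t => b (Function.update (shift x l) l t)) =
              fun t => b (Function.update x l t) := by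
            ext t
            congr 1
            ext j
            by_cases hj : j = l
            · subst hj; simp
            · simp [shift, hj]
          have h2 : shift x l l = x l + 1 := by simp [shift]
          have h3 := hS (fun t => b (Function.update x l t)) (x l)
          rw [Function.update_eq_self] at h3
          simp only [h1, h2]
          simp only [hb] at h3 ⊢
          linarith
      · exact ⟨w, fun x i hi => hw x i (by have := i.2; omega)⟩
  obtain ⟨w, hw⟩ := key d
  exact ⟨w, fun x i => hw x i i.2⟩

/-- If every bond off `F` lying in a common unit square with a bond of `F` is open in `ω`, then
opening all the bonds off `F` does not connect the end points of a bond of `F`. -/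
theorem endsJoined_glue_of_shielded {F : Finset (Bond d)} {ω : Config d}
    (h : ∀ g ∈ F, ∀ e ∉ F, SqAdj g e → ω e = true) (ζ : F → Bool) {e : Bond d} (he : e ∈ F)
    (hj : EndsJoined (glue F ζ fun _ => true) e) : EndsJoined (glue F ζ ω) e := by
  classical
  obtain ⟨x₀, i₀, rfl⟩ := exists_eq_bond e
  have hj' : (openGraph (glue F ζ fun _ => true)).Reachable x₀ (shift x₀ i₀) := endsJoined_mk.1 hj
  refine endsJoined_mk.2 ?_
  set u : (Fin d → ℤ) → ℤ := fun y => if (openGraph (glue F ζ ω)).Reachable x₀ y then 1 else 0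
    with hu
  have hopen : ∀ x i, glue F ζ ω (bond x i) = true → u (shift x i) = u x := by
    intro x i ho
    have hadj : (openGraph (glue F ζ ω)).Adj x (shift x i) :=
      openGraph_adj.2 ⟨l1Dist_shift x i, ho⟩
    simp only [hu]
    congr 1
    exact propext ⟨fun h => h.trans hadj.symm.reachable, fun h => h.trans hadj.reachable⟩
  -- `c` is the gradient of the cluster indicator `u`, set to zero on `F`. In a square with a side
  -- in `F`, the sides off `F` are open, so all four values vanish; in any other square `c` is a
  -- genuine gradient.
  set c : (Fin d → ℤ) → Fin d → ℤ :=
    fun x i => if bond x i ∈ F then 0 else u (shift x i) - u x with hcdef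
  have hcF : ∀ x i, bond x i ∈ F → c x i = 0 := fun x i hb => if_pos hb
  have hcN : ∀ x i, bond x i ∉ F → c x i = u (shift x i) - u x := fun x i hb => if_neg hb
  have hclosed : ∀ x i j, i ≠ j → c x i + c (shift x i) j = c x j + c (shift x j) i := by
    intro x i j hij
    by_cases hsq : ∃ g ∈ F, g ∈ square x i j
    · obtain ⟨g, hgF, hg⟩ := hsq
      have hz : ∀ y k, bond y k ∈ square x i j → c y k = 0 := by
        intro y k hy
        by_cases hyF : bond y k ∈ F
        · exact hcF _ _ hyF
        · rw [hcN _ _ hyF, hopen y k, sub_self]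
          rw [glue_apply_notMem hyF]
          exact h g hgF _ hyF ⟨x, i, j, hij, hg, hy⟩
      rw [hz x i (by simp [square]), hz x j (by simp [square]),
        hz (shift x i) j (by simp [square]), hz (shift x j) i (by simp [square])]
    · push Not at hsq
      rw [hcN x i (fun hF => hsq _ hF (by simp [square])),
        hcN x j (fun hF => hsq _ hF (by simp [square])),
        hcN (shift x i) j (fun hF => hsq _ hF (by simp [square])),
        hcN (shift x j) i (fun hF => hsq _ hF (by simp [square])), shift_comm x i j]
      ring
  obtain ⟨w, hw⟩ := exists_potential c hclosed
  -- Along bonds open in the wired configuration `w` and `u` have equal increments: off `F` by the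
  -- choice of `c`, on `F` because both increments vanish. Since `w` has increment zero across `e`,
  -- so does `u`.
  have hstep : ∀ x i, glue F ζ (fun _ => true) (bond x i) = true →
      w (shift x i) - u (shift x i) = w x - u x := by
    intro x i ho
    have h1 := hw x i
    by_cases hF : bond x i ∈ F
    · rw [hcF x i hF] at h1
      have := hopen x i (by rwa [glue_apply_mem hF] at ho ⊢)
      linarith
    · rw [hcN x i hF] at h1
      linarith
  have hconst : ∀ y, (openGraph (glue F ζ fun _ => true)).Reachable x₀ y →
      w y - u y = w x₀ - u x₀ := by
    intro y hy
    rw [SimpleGraph.reachable_iff_reflTransGen] at hy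
    induction hy with
    | refl => rfl
    | @tail v z _ hvz ih =>
      obtain ⟨hl, ho⟩ := openGraph_adj.1 hvz
      obtain ⟨i, rfl | rfl⟩ := exists_shift_of_l1Dist (show l1Dist v z = 1 from hl)
      · rw [← ih]; exact hstep v i ho
      · rw [← ih]
        refine (hstep z i ?_).symm
        convert ho using 2
        exact Subtype.ext Sym2.eq_swap
  have h1 := hconst _ hj'
  have h2 := hw x₀ i₀
  rw [hcF x₀ i₀ he] at h2
  have h3 : u x₀ = 1 := by simp [hu]
  have h4 : u (shift x₀ i₀) = 1 := by linarith
  by_contra hcon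
  simp [hu, hcon] at h4

theorem endsJoined_glue_iff_of_shielded {F : Finset (Bond d)} {ω : Config d}
    (h : ∀ g ∈ F, ∀ e ∉ F, SqAdj g e → ω e = true) (ζ : F → Bool) {e : Bond d} (he : e ∈ F) :
    EndsJoined (glue F ζ ω) e ↔ EndsJoined (glue F ζ fun _ => true) e :=
  ⟨EndsJoined.mono (glue_mono le_rfl fun _ => Bool.le_true _), endsJoined_glue_of_shielded h ζ he⟩

/-! ### Exploration from outside, and comparison with the wired measure. -/

/-- The bonds that are off `E` or are joined to the complement of `E` by a sequence of closed
bonds, consecutive ones lying in a common unit square. -/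
def closedReach (E : Finset (Bond d)) (ω : Config d) : Set (Bond d) :=
  {f | ∃ e ∉ E, Relation.ReflTransGen (fun a b => SqAdj a b ∧ ω b = false) e f}

theorem mem_closedReach_of_notMem {E : Finset (Bond d)} {ω : Config d} {e : Bond d} (he : e ∉ E) :
    e ∈ closedReach E ω := ⟨e, he, .refl⟩

theorem mem_closedReach_of_sqAdj {E : Finset (Bond d)} {ω : Config d} {e f : Bond d}
    (he : e ∈ closedReach E ω) (hef : SqAdj e f) (hf : ω f = false) : f ∈ closedReach E ω := by
  obtain ⟨g, hg, h⟩ := he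
  exact ⟨g, hg, h.tail ⟨hef, hf⟩⟩

theorem closedReach_induction {E : Finset (Bond d)} {ω : Config d} {P : Bond d → Prop}
    (base : ∀ e ∉ E, P e)
    (step : ∀ e ∈ closedReach E ω, P e → ∀ f, SqAdj e f → ω f = false → P f)
    {f : Bond d} (hf : f ∈ closedReach E ω) : P f := by
  obtain ⟨e, he, h⟩ := hf
  induction h with
  | refl => exact base e he
  | @tail b c hb hbc ih => exact step b ⟨e, he, hb⟩ ih c hbc.1 hbc.2

/-- The bonds whose states are revealed by an exploration of `closedReach E ω`. -/
def explored (E : Finset (Bond d)) (ω : Config d) : Set (Bond d) :=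
  {g | g ∈ closedReach E ω ∨ ∃ k ∈ closedReach E ω, SqAdj k g}

open Classical in
/-- The bonds of `E` left unexplored. -/
noncomputable def unexplored (E : Finset (Bond d)) (ω : Config d) : Finset (Bond d) :=
  E.filter (· ∉ explored E ω)

theorem mem_unexplored {E : Finset (Bond d)} {ω : Config d} {e : Bond d} :
    e ∈ unexplored E ω ↔ e ∉ explored E ω := by
  simp only [unexplored, Finset.mem_filter, and_iff_right_iff_imp]
  intro h
  by_contra he
  exact h (Or.inl (mem_closedReach_of_notMem he))

/-- The exploration stops only at open bonds: a closed one would have been reached and would have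
revealed its neighbours. This is the shielding hypothesis of `endsJoined_glue_of_shielded`. -/
theorem open_of_sqAdj_unexplored {E : Finset (Bond d)} {ω : Config d} :
    ∀ g ∈ unexplored E ω, ∀ e ∉ unexplored E ω, SqAdj g e → ω e = true := by
  intro g hg e he hge
  rw [mem_unexplored] at hg he
  rw [not_not] at he
  have hne : e ∉ closedReach E ω := fun h => hg (Or.inr ⟨e, h, hge.symm⟩)
  rcases he with h | ⟨k, hk, hke⟩
  · exact absurd h hne
  · by_contra hcl
    exact hne (mem_closedReach_of_sqAdj hk hke (Bool.eq_false_iff.2 hcl))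

/-- The exploration reads only the states it reveals. Hence the event that the unexplored set equals
`F` is determined off `F`, which permits conditioning on it. -/
theorem unexplored_congr {E : Finset (Bond d)} {ω ω' : Config d}
    (h : ∀ e ∉ unexplored E ω, ω' e = ω e) : unexplored E ω' = unexplored E ω := by
  have h' : ∀ e ∈ explored E ω, ω' e = ω e := fun e he =>
    h e fun hu => (mem_unexplored.1 hu) he
  have hK : closedReach E ω' = closedReach E ω := by
    apply Set.Subset.antisymm
    · intro f hf
      refine closedReach_induction (P := (· ∈ closedReach E ω))
        (fun e he => mem_closedReach_of_notMem he) (fun e _ hP f hef hf => ?_) hf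
      refine mem_closedReach_of_sqAdj hP hef ?_
      rw [← h' f (Or.inr ⟨e, hP, hef⟩), hf]
    · intro f hf
      refine closedReach_induction (P := (· ∈ closedReach E ω'))
        (fun e he => mem_closedReach_of_notMem he) (fun e he hP f hef hf => ?_) hf
      refine mem_closedReach_of_sqAdj hP hef ?_
      rw [h' f (Or.inr ⟨e, he, hef⟩), hf]
  ext e
  rw [mem_unexplored, mem_unexplored, explored, explored, hK]

/-- The event `A` depends only on the states of the bonds in `L`. -/
def DependsOnBonds (A : Set (Config d)) (L : Finset (Bond d)) : Prop :=
  ∀ ω ω' : Config d, (∀ e ∈ L, ω e = ω' e) → (ω ∈ A ↔ ω' ∈ A)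

/-- The indicator function of an event. -/
noncomputable def ind (A : Set (Config d)) : Config d → ℝ := A.indicator 1

theorem ind_nonneg (A : Set (Config d)) : 0 ≤ ind A :=
  fun ω => Set.indicator_nonneg (fun _ _ => zero_le_one) ω

theorem ind_le_one (A : Set (Config d)) (ω : Config d) : ind A ω ≤ 1 :=
  Set.indicator_le' (fun _ _ => le_rfl) (fun _ _ => zero_le_one) ω

theorem ind_mono {A : Set (Config d)} (hA : IsUpperSet A) : Monotone (ind A) := by
  intro ω ω' h
  by_cases hω : ω ∈ A
  · rw [ind, Set.indicator_of_mem hω, Set.indicator_of_mem (hA h hω)]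
    rfl
  · rw [ind, Set.indicator_of_notMem hω]
    exact ind_nonneg A ω'

-- Decompose according to the unexplored set `F`, keeping those that contain `L`: given `F`, the law
-- on `F` is wired, and for `A` it dominates the wired law on `E`.
open Classical in
theorem expect_mul_expect_le (hp : 0 < p) (hp1 : p ≤ 1) (hq : 1 ≤ q) {E L : Finset (Bond d)}
    (η : Config d) {A : Set (Config d)} (hA : IsUpperSet A)
    (hAL : DependsOnBonds A L) :
    expect p q E η (fun ω => if L ⊆ unexplored E ω then 1 else 0) *
      expect p q E (fun _ => true) (ind A) ≤ expect p q E η (ind A) := by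
  set b := expect p q E (fun _ => true) (ind A) with hb
  let g : Finset (Bond d) → Config d → ℝ := fun F ω => if unexplored E ω = F then 1 else 0
  -- Resampling `F` under the wired measure on `E` uses random boundary conditions, each below the
  -- wired one.
  have hFb : ∀ F ⊆ E, b ≤ expect p q F (fun _ => true) (ind A) := by
    intro F hF
    rw [hb, ← expect_expect hp hp1 hq hF]
    refine (expect_mono hp hp1 hq (g := fun _ => expect p q F (fun _ => true) (ind A))
      fun ζ => ?_).trans_eq (expect_const hp hp1 hq _ _ _)
    exact expect_mono_boundary hp hp1 hq F (fun _ => Bool.le_true _) (ind_nonneg A) (ind_mono hA)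
  have hF : ∀ F ⊆ E, L ⊆ F →
      expect p q E η (g F) * b ≤ expect p q E η (fun ω => g F ω * ind A ω) := by
    intro F hFE hLF
    have hg : ∀ (ω : Config d) (ξ : F → Bool), g F (glue F ξ ω) = g F ω := by
      intro ω ξ
      have : unexplored E (glue F ξ ω) = F ↔ unexplored E ω = F := by
        constructor
        · intro h
          rw [← h]
          refine unexplored_congr fun e he => ?_
          rw [h] at he
          rw [glue_apply_notMem he]
        · intro h
          conv_rhs => rw [← h]
          refine unexplored_congr fun e he => ?_
          rw [h] at he
          rw [glue_apply_notMem he]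
      simp only [g, this]
    rw [← expect_mul_const, ← expect_expect hp hp1 hq hFE η (fun ω => g F ω * ind A ω)]
    refine expect_mono hp hp1 hq fun ζ => ?_
    set ω := glue E ζ η
    rw [expect_congr (g := fun ω' => g F ω * ind A ω') (fun ξ => by rw [hg]), expect_const_mul]
    by_cases hω : unexplored E ω = F
    · have : expect p q F ω (ind A) = expect p q F (fun _ => true) (ind A) := by
        refine expect_eq_of_endsJoined_iff hp hp1 hq (fun ξ e he => ?_) fun ξ => ?_
        · refine endsJoined_glue_iff_of_shielded ?_ ξ he
          rw [← hω]
          exact open_of_sqAdj_unexplored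
        · have := hAL (glue F ξ ω) (glue F ξ fun _ => true) fun e he => by
            rw [glue_apply_mem (hLF he), glue_apply_mem (hLF he)]
          by_cases h : glue F ξ ω ∈ A
          · rw [ind, Set.indicator_of_mem h, Set.indicator_of_mem (this.1 h)]
            rfl
          · rw [ind, Set.indicator_of_notMem h, Set.indicator_of_notMem (fun h' => h (this.2 h'))]
      rw [this]
      refine mul_le_mul_of_nonneg_left (hFb F hFE) ?_
      simp only [g]
      split_ifs; norm_num
    · simp [g, hω]
  have hsum : ∀ ω, ∑ F ∈ E.powerset.filter (L ⊆ ·), g F ω =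
      if L ⊆ unexplored E ω then 1 else 0 := by
    intro ω
    have hE : unexplored E ω ⊆ E := Finset.filter_subset _ _
    simp only [g, Finset.sum_ite_eq, Finset.mem_filter, Finset.mem_powerset, hE, true_and]
  calc expect p q E η (fun ω => if L ⊆ unexplored E ω then 1 else 0) * b
      = ∑ F ∈ E.powerset.filter (L ⊆ ·), expect p q E η (g F) * b := by
        rw [← Finset.sum_mul, ← expect_sum]
        simp only [hsum]
    _ ≤ ∑ F ∈ E.powerset.filter (L ⊆ ·), expect p q E η (fun ω => g F ω * ind A ω) := by
        refine Finset.sum_le_sum fun F hF' => ?_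
        rw [Finset.mem_filter, Finset.mem_powerset] at hF'
        exact hF F hF'.1 hF'.2
    _ = expect p q E η (fun ω => (if L ⊆ unexplored E ω then 1 else 0) * ind A ω) := by
        rw [← expect_sum]
        simp only [← Finset.sum_mul, hsum]
    _ ≤ expect p q E η (ind A) := by
        refine expect_mono hp hp1 hq fun ζ => ?_
        have := ind_nonneg A (glue E ζ η)
        simp only [Pi.zero_apply] at this
        split_ifs <;> linarith

open Classical in
theorem expect_wired_sub_expect_le (hp : 0 < p) (hp1 : p ≤ 1) (hq : 1 ≤ q)
    {E L : Finset (Bond d)} (η : Config d) {A : Set (Config d)} (hA : IsUpperSet A)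
    (hAL : DependsOnBonds A L) :
    expect p q E (fun _ => true) (ind A) - expect p q E η (ind A) ≤
      expect p q E η (fun ω => if L ⊆ unexplored E ω then 0 else 1) := by
  have h1 := expect_mul_expect_le hp hp1 hq (E := E) η hA hAL
  set b := expect p q E (fun _ => true) (ind A)
  have hb : b ≤ 1 := (expect_mono hp hp1 hq fun _ => ind_le_one A _).trans_eq
    (expect_const hp hp1 hq _ _ 1)
  have h2 : expect p q E η (fun ω => if L ⊆ unexplored E ω then 0 else 1) =
      1 - expect p q E η (fun ω => if L ⊆ unexplored E ω then 1 else 0) := by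
    have h := expect_sub (p := p) (q := q) E η (fun _ => 1)
      (fun ω => if L ⊆ unexplored E ω then 1 else 0)
    rw [expect_const hp hp1 hq] at h
    rw [← h]
    exact expect_congr fun ζ => by split_ifs <;> norm_num
  have h3 : 0 ≤ expect p q E η (fun ω => if L ⊆ unexplored E ω then (0 : ℝ) else 1) := by
    refine (expect_const hp hp1 hq E η 0).symm.trans_le (expect_mono hp hp1 hq fun ζ => ?_)
    split_ifs <;> norm_num
  -- If P is the probability that `L` stays unexplored, `h1` gives a gap of at most b(1 - P), and b
  -- ≤ 1.
  rw [h2] at h3 ⊢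
  nlinarith

/-! ### Local geometry: neighbouring bonds, thickenings, boundaries. -/

theorem shift_ne_shift_shift {x y : Fin d → ℤ} {i j : Fin d} (h : x = shift y j) :
    shift x i ≠ y := by
  intro h'
  have h1 := congrFun h i
  have h2 := congrFun h' i
  have h3 : (0 : ℤ) ≤ (Pi.single j 1 : Fin d → ℤ) i := by
    by_cases hij : i = j
    · subst hij; simp
    · simp [Pi.single_eq_of_ne hij]
  simp only [shift, Pi.add_apply, Pi.single_eq_same] at h1 h2
  omega

theorem bond_inj {x y : Fin d → ℤ} {i j : Fin d} : bond x i = bond y j ↔ x = y ∧ i = j := by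
  refine ⟨fun h => ?_, fun h => by rw [h.1, h.2]⟩
  rcases Sym2.eq_iff.1 (congrArg Subtype.val h) with ⟨rfl, h2⟩ | ⟨h1, h2⟩
  · refine ⟨rfl, ?_⟩
    by_contra hij
    have := congrFun h2 i
    simp [shift, Pi.single_eq_of_ne hij] at this
  · exact absurd h2 (shift_ne_shift_shift h1)

-- The candidates are the bond itself and six bonds for each direction `j`; 6d + 1 ≤ 4^d for d ≥ 2.
-- Nonemptiness is needed by `mem_chainsFrom`.
open Classical in
theorem exists_sqAdj_finset (hd : 2 ≤ d) (e : Bond d) :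
    ∃ N : Finset (Bond d), N.card ≤ 4 ^ d ∧ N.Nonempty ∧ ∀ f, SqAdj e f → f ∈ N := by
  obtain ⟨x, i, rfl⟩ := exists_eq_bond e
  have hb : ∀ (y : Fin d → ℤ) (j : Fin d), shift y j - Pi.single j 1 = y := fun y j =>
    add_sub_cancel_right _ _
  refine ⟨insert (bond x i) (Finset.univ.biUnion fun j : Fin d =>
    {bond x j, bond (shift x i) j, bond (shift x j) i, bond (x - Pi.single j 1) j,
      bond (x - Pi.single j 1) i, bond (shift (x - Pi.single j 1) i) j}), ?_,
    Finset.insert_nonempty _ _, ?_⟩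
  · refine (Finset.card_insert_le _ _).trans ?_
    refine (Nat.add_le_add_right (Finset.card_biUnion_le_card_mul _ _ 6
      fun j _ => Finset.card_le_six) 1).trans ?_
    rw [Finset.card_univ, Fintype.card_fin]
    induction d, hd using Nat.le_induction with
    | base => norm_num
    | succ n hn ih =>
      have : n * 6 + 1 ≤ 4 ^ n := by
        clear ih hb x i
        induction n, hn using Nat.le_induction with
        | base => norm_num
        | succ m hm ih => rw [pow_succ]; omega
      rw [pow_succ]; omega
  · rintro f ⟨y, k, l, -, he, hf⟩
    simp only [Finset.mem_insert, Finset.mem_biUnion, Finset.mem_univ, true_and,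
      Finset.mem_singleton]
    simp only [square, Set.mem_insert_iff, Set.mem_singleton_iff, bond_inj] at he hf
    rcases he with ⟨rfl, rfl⟩ | ⟨rfl, rfl⟩ | ⟨rfl, rfl⟩ | ⟨rfl, rfl⟩
    · rcases hf with rfl | rfl | rfl | rfl
      exacts [Or.inl rfl, Or.inr ⟨l, by simp⟩, Or.inr ⟨l, by simp⟩, Or.inr ⟨l, by simp⟩]
    · rcases hf with rfl | rfl | rfl | rfl
      exacts [Or.inr ⟨k, by simp⟩, Or.inl rfl, Or.inr ⟨k, by simp⟩, Or.inr ⟨k, by simp⟩]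
    · rcases hf with rfl | rfl | rfl | rfl
      exacts [Or.inr ⟨k, by simp [hb]⟩, Or.inr ⟨k, by simp [hb]⟩, Or.inl rfl,
        Or.inr ⟨k, by simp [hb]⟩]
    · rcases hf with rfl | rfl | rfl | rfl
      exacts [Or.inr ⟨l, by simp [hb]⟩, Or.inr ⟨l, by simp [hb]⟩, Or.inr ⟨l, by simp [hb]⟩,
        Or.inl rfl]

/-- Every corner of a unit square is at distance at most one from an end of any given side; so one
step of the exploration advances by at most one layer of `thicken`. -/
theorem SqAdj.exists_l1Dist_le {e f : Bond d} (h : SqAdj e f) {y : Fin d → ℤ}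
    (hy : y ∈ (f : Sym2 (Fin d → ℤ))) : ∃ x ∈ (e : Sym2 (Fin d → ℤ)), l1Dist x y ≤ 1 := by
  obtain ⟨z, i, j, -, he, hf⟩ := h
  have hs := fun (x : Fin d → ℤ) (i : Fin d) => (l1Dist_shift x i).le
  have hs' := fun (x : Fin d → ℤ) (i : Fin d) => ((l1Dist_comm _ _).trans (l1Dist_shift x i)).le
  have h0 := fun (x : Fin d → ℤ) => (l1Dist_self x).le.trans zero_le_one
  have hji : ∀ z, shift (shift z j) i = shift (shift z i) j := fun z => shift_comm z j i
  have hV : y = z ∨ y = shift z i ∨ y = shift z j ∨ y = shift (shift z i) j := by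
    rcases hf with rfl | rfl | rfl | rfl <;> rw [mem_bond] at hy <;>
      rcases hy with rfl | rfl <;> simp [hji]
  have hc := shift_comm z i j
  rcases he with rfl | rfl | rfl | rfl
  · rcases hV with rfl | rfl | rfl | rfl
    exacts [⟨_, mem_bond.2 (.inl rfl), h0 _⟩, ⟨_, mem_bond.2 (.inr rfl), h0 _⟩,
      ⟨_, mem_bond.2 (.inl rfl), hs _ _⟩, ⟨_, mem_bond.2 (.inr rfl), hs _ _⟩]
  · rcases hV with rfl | rfl | rfl | rfl
    exacts [⟨_, mem_bond.2 (.inl rfl), h0 _⟩, ⟨_, mem_bond.2 (.inl rfl), hs _ _⟩,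
      ⟨_, mem_bond.2 (.inr rfl), h0 _⟩, ⟨_, mem_bond.2 (.inr rfl), by rw [hc]; exact hs _ _⟩]
  · rcases hV with rfl | rfl | rfl | rfl
    exacts [⟨_, mem_bond.2 (.inl rfl), hs' _ _⟩, ⟨_, mem_bond.2 (.inl rfl), h0 _⟩,
      ⟨_, mem_bond.2 (.inr rfl), by rw [hc]; exact hs' _ _⟩, ⟨_, mem_bond.2 (.inr rfl), h0 _⟩]
  · rcases hV with rfl | rfl | rfl | rfl
    exacts [⟨_, mem_bond.2 (.inl rfl), hs' _ _⟩,
      ⟨_, mem_bond.2 (.inr rfl), by rw [← hc]; exact hs' _ _⟩,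
      ⟨_, mem_bond.2 (.inl rfl), h0 _⟩, ⟨_, mem_bond.2 (.inr rfl), by rw [← hc]; exact h0 _⟩]

open Classical in
/-- The vertices at distance at most `k` from `Λ`. -/
noncomputable def thicken (Λ : Finset (Fin d → ℤ)) (k : ℕ) : Finset (Fin d → ℤ) :=
  Λ.biUnion fun y => (Fintype.piFinset fun i => Finset.Icc (y i - k) (y i + k)).filter
    fun x => l1Dist y x ≤ k

theorem mem_thicken {Λ : Finset (Fin d → ℤ)} {k : ℕ} {x : Fin d → ℤ} :
    x ∈ thicken Λ k ↔ ∃ y ∈ Λ, l1Dist y x ≤ k := by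
  simp only [thicken, Finset.mem_biUnion, Finset.mem_filter, Fintype.mem_piFinset,
    Finset.mem_Icc]
  refine ⟨fun ⟨y, hy, h⟩ => ⟨y, hy, h.2⟩, fun ⟨y, hy, h⟩ => ⟨y, hy, fun i => ?_, h⟩⟩
  have : (y i - x i).natAbs ≤ l1Dist y x :=
    Finset.single_le_sum (f := fun i => (y i - x i).natAbs) (fun _ _ => Nat.zero_le _)
      (Finset.mem_univ i)
  omega

theorem innerBonds_mono {Λ Λ' : Finset (Fin d → ℤ)} (h : Λ ⊆ Λ') :
    innerBonds Λ ⊆ innerBonds Λ' := fun _ he =>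
  (mem_innerBonds _ _).2 fun x hx => h ((mem_innerBonds _ _).1 he x hx)

theorem thicken_mono (Λ : Finset (Fin d → ℤ)) {k l : ℕ} (h : k ≤ l) :
    thicken Λ k ⊆ thicken Λ l := fun x hx => by
  obtain ⟨y, hy, hyx⟩ := mem_thicken.1 hx
  exact mem_thicken.2 ⟨y, hy, hyx.trans h⟩

theorem subset_thicken (Λ : Finset (Fin d → ℤ)) (k : ℕ) : Λ ⊆ thicken Λ k := fun x hx =>
  mem_thicken.2 ⟨x, hx, by rw [l1Dist_self]; exact Nat.zero_le k⟩

theorem SqAdj.mem_innerBonds_thicken {Λ : Finset (Fin d → ℤ)} {k : ℕ} {e f : Bond d}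
    (h : SqAdj e f) (he : e ∈ innerBonds (thicken Λ k)) :
    f ∈ innerBonds (thicken Λ (k + 1)) := by
  refine (mem_innerBonds _ _).2 fun y hy => ?_
  obtain ⟨x, hx, hxy⟩ := h.exists_l1Dist_le hy
  obtain ⟨z, hz, hzx⟩ := mem_thicken.1 ((mem_innerBonds _ _).1 he x hx)
  exact mem_thicken.2 ⟨z, hz, (l1Dist_triangle z x y).trans (by omega)⟩

/-- The bond `e` has an end point in `∂Λ`. -/
def TouchesBoundary (Λ : Finset (Fin d → ℤ)) (e : Bond d) : Prop :=
  ∃ y ∈ (e : Sym2 (Fin d → ℤ)), y ∈ boundary Λ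

theorem eq_of_l1Dist_eq_zero {x y : Fin d → ℤ} (h : l1Dist x y = 0) : x = y := by
  ext i
  have := Finset.sum_eq_zero_iff.1 h i (Finset.mem_univ i)
  omega

/-- The exploration cannot reveal a bond of 𝔼_Λ from outside without passing through a bond that
meets ∂Λ. -/
theorem SqAdj.touchesBoundary {Λ : Finset (Fin d → ℤ)} {e f : Bond d} (h : SqAdj e f)
    (he : e ∉ innerBonds Λ) (hf : f ∈ innerBonds Λ) : TouchesBoundary Λ e := by
  rw [mem_innerBonds] at he hf
  push Not at he
  obtain ⟨y, hy, hyΛ⟩ := he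
  obtain ⟨x, hx, hxy⟩ := h.symm.exists_l1Dist_le hy
  refine ⟨y, hy, hyΛ, x, hf x hx, ?_⟩
  by_contra hne
  have := eq_of_l1Dist_eq_zero (show l1Dist x y = 0 by omega)
  exact hyΛ (this ▸ hf x hx)

theorem l1Dist_le_one_of_mem {e : Bond d} {x y : Fin d → ℤ} (hx : x ∈ (e : Sym2 (Fin d → ℤ)))
    (hy : y ∈ (e : Sym2 (Fin d → ℤ))) : l1Dist x y ≤ 1 := by
  obtain ⟨z, i, rfl⟩ := exists_eq_bond e
  rcases mem_bond.1 hx with rfl | rfl <;> rcases mem_bond.1 hy with rfl | rfl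
  · simp [l1Dist_self]
  · exact (l1Dist_shift _ _).le
  · rw [l1Dist_comm]; exact (l1Dist_shift _ _).le
  · simp [l1Dist_self]

theorem TouchesBoundary.mem_innerBonds_thicken {Λ : Finset (Fin d → ℤ)} {e : Bond d}
    (h : TouchesBoundary Λ e) : e ∈ innerBonds (thicken Λ 2) := by
  obtain ⟨y, hy, -, x, hx, hxy⟩ := h
  refine (mem_innerBonds _ _).2 fun z hz => mem_thicken.2 ⟨x, hx, ?_⟩
  have := l1Dist_triangle x y z
  have := l1Dist_le_one_of_mem hy hz
  omega

theorem boundary_finite (Λ : Finset (Fin d → ℤ)) : (boundary Λ).Finite :=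
  (thicken Λ 1).finite_toSet.subset fun _ ⟨_, x, hx, hxy⟩ => mem_thicken.2 ⟨x, hx, hxy.le⟩

theorem boundary_ncard_pos (hd : 0 < d) {Λ : Finset (Fin d → ℤ)} (hΛ : Λ.Nonempty) :
    0 < (boundary Λ).ncard := by
  rw [Set.ncard_pos (boundary_finite Λ)]
  obtain ⟨x, hx, hmax⟩ := Λ.exists_max_image (fun x => x ⟨0, hd⟩) hΛ
  refine ⟨shift x ⟨0, hd⟩, fun h => ?_, x, hx, l1Dist_shift _ _⟩
  have := hmax _ h
  simp [shift] at this

open Classical in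
theorem exists_touchesBoundary_finset (Λ : Finset (Fin d → ℤ)) :
    ∃ S : Finset (Bond d), S.card ≤ 2 * d * (boundary Λ).ncard ∧
      ∀ e, TouchesBoundary Λ e → e ∈ S := by
  refine ⟨(boundary_finite Λ).toFinset.biUnion fun y => Finset.univ.biUnion fun i : Fin d =>
    {bond y i, bond (y - Pi.single i 1) i}, ?_, ?_⟩
  · refine (Finset.card_biUnion_le_card_mul _ _ (d * 2) fun y _ => ?_).trans ?_
    · refine (Finset.card_biUnion_le_card_mul _ _ 2 fun i _ => Finset.card_le_two).trans ?_
      rw [Finset.card_univ, Fintype.card_fin]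
    · rw [← Set.ncard_eq_toFinset_card _ (boundary_finite Λ)]
      exact le_of_eq (by ring)
  · rintro e ⟨y, hy, hyb⟩
    obtain ⟨x, i, rfl⟩ := exists_eq_bond e
    simp only [Finset.mem_biUnion, Set.Finite.mem_toFinset, Finset.mem_univ, true_and,
      Finset.mem_insert, Finset.mem_singleton]
    refine ⟨y, hyb, i, ?_⟩
    rcases mem_bond.1 hy with rfl | rfl
    · exact Or.inl rfl
    · exact Or.inr (by rw [shift, add_sub_cancel_right])

/-! ### Closed chains and the Peierls estimate. -/

open Classical in
/-- The lists of `n` bonds that start at `e` and have consecutive terms related by `N`. -/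
noncomputable def chainsFrom (N : Bond d → Finset (Bond d)) :
    ℕ → Bond d → Finset (List (Bond d))
  | 0, _ => {[]}
  | n + 1, e => ((N e).biUnion (chainsFrom N n)).image (List.cons e)

theorem card_chainsFrom_le {N : Bond d → Finset (Bond d)} {K : ℕ} (hN : ∀ e, (N e).card ≤ K)
    (n : ℕ) (e : Bond d) : (chainsFrom N n e).card ≤ K ^ n := by
  classical
  induction n generalizing e with
  | zero => simp [chainsFrom]
  | succ n ih =>
    rw [chainsFrom]
    refine Finset.card_image_le.trans ((Finset.card_biUnion_le_card_mul _ _ (K ^ n)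
      fun f _ => ih f).trans ?_)
    rw [pow_succ']
    exact Nat.mul_le_mul_right _ (hN e)

theorem length_of_mem_chainsFrom {N : Bond d → Finset (Bond d)} {n : ℕ} {e : Bond d}
    {l : List (Bond d)} (h : l ∈ chainsFrom N n e) : l.length = n := by
  classical
  induction n generalizing e l with
  | zero => simp_all [chainsFrom]
  | succ n ih =>
    simp only [chainsFrom, Finset.mem_image, Finset.mem_biUnion] at h
    obtain ⟨l', ⟨f, _, hl'⟩, rfl⟩ := h
    simp [ih hl']

theorem mem_chainsFrom {N : Bond d → Finset (Bond d)} (hN0 : ∀ e, (N e).Nonempty)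
    {l : List (Bond d)} {e : Bond d} (h : (e :: l).IsChain fun a b => b ∈ N a) :
    e :: l ∈ chainsFrom N (l.length + 1) e := by
  classical
  induction l generalizing e with
  | nil =>
    -- The recursion ranges over `N e` even for a one-term list, so `N e` must not be empty.
    obtain ⟨f, hf⟩ := hN0 e
    simp only [chainsFrom, Finset.mem_image, Finset.mem_biUnion, List.length_nil]
    exact ⟨[], ⟨f, hf, Finset.mem_singleton_self _⟩, rfl⟩
  | cons f l ih =>
    rw [List.isChain_cons_cons] at h
    rw [chainsFrom, Finset.mem_image]
    exact ⟨f :: l, Finset.mem_biUnion.2 ⟨f, h.1, ih h.2⟩, rfl⟩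

/-- The adjacency of distinct closed bonds of `E` lying in a common unit square. -/
def closedGraph (E : Finset (Bond d)) (ω : Config d) : SimpleGraph (Bond d) where
  Adj a b := a ≠ b ∧ SqAdj a b ∧ (a ∈ E ∧ ω a = false) ∧ (b ∈ E ∧ ω b = false)
  symm := ⟨fun _ _ h => ⟨h.1.symm, h.2.1.symm, h.2.2.2, h.2.2.1⟩⟩
  loopless := ⟨fun _ h => h.1 rfl⟩

theorem closed_of_mem_support {E : Finset (Bond d)} {ω : Config d} {e f : Bond d}
    (he : e ∈ E ∧ ω e = false) (w : (closedGraph E ω).Walk e f) :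
    ∀ g ∈ w.support, g ∈ E ∧ ω g = false := by
  induction w with
  | nil => simpa using he
  | cons h w ih =>
    intro g hg
    rw [SimpleGraph.Walk.support_cons, List.mem_cons] at hg
    rcases hg with rfl | hg
    · exact he
    · exact ih h.2.2.2 g hg

theorem mem_innerBonds_thicken_of_walk {Λ : Finset (Fin d → ℤ)} {E : Finset (Bond d)}
    {ω : Config d} {e f : Bond d} (w : (closedGraph E ω).Walk e f) {k : ℕ}
    (he : e ∈ innerBonds (thicken Λ k)) : f ∈ innerBonds (thicken Λ (k + w.length)) := by
  induction w generalizing k with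
  | nil => simpa using he
  | cons h w ih =>
    have := ih (h.2.1.mem_innerBonds_thicken he)
    rwa [SimpleGraph.Walk.length_cons, add_comm w.length 1, ← add_assoc]

theorem exists_closed_chain {N : Bond d → Finset (Bond d)} (hN0 : ∀ e, (N e).Nonempty)
    (hN : ∀ e f, SqAdj e f → f ∈ N e) {Λ : Finset (Fin d → ℤ)} {r : ℕ} {ω : Config d}
    (h : ¬ innerBonds Λ ⊆ unexplored (innerBonds (thicken Λ (r - 1))) ω) :
    ∃ f, TouchesBoundary Λ f ∧ ∃ l ∈ chainsFrom N (r - 2) f, l.Nodup ∧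
      ∀ e ∈ l, e ∈ innerBonds (thicken Λ (r - 1)) ∧ ω e = false := by
  set E := innerBonds (thicken Λ (r - 1)) with hE
  have hΛE : innerBonds Λ ⊆ E := innerBonds_mono (subset_thicken _ _)
  obtain ⟨k, hk, hkb⟩ : ∃ k ∈ closedReach E ω, TouchesBoundary Λ k := by
    by_contra! hcon
    have hdisj : ∀ k ∈ closedReach E ω, k ∉ innerBonds Λ := by
      intro k hk
      refine closedReach_induction (P := (· ∉ innerBonds Λ)) (fun e he h' => he (hΛE h'))
        (fun e he hP f hef _ hf => hcon e he (hef.touchesBoundary hP hf)) hk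
    refine h fun g hg => mem_unexplored.2 ?_
    rintro (hgr | ⟨k, hk, hkg⟩)
    · exact hdisj g hgr hg
    · exact hcon k hk (hkg.touchesBoundary (hdisj k hk) hg)
  refine ⟨k, hkb, ?_⟩
  -- For r < 3 the truncated difference r - 2 is zero and the empty chain suffices.
  rcases Nat.lt_or_ge r 3 with hr | hr
  · refine ⟨[], ?_, List.nodup_nil, by simp⟩
    rw [show r - 2 = 0 by omega]
    exact Finset.mem_singleton_self _
  have hkE : k ∈ E := innerBonds_mono (thicken_mono Λ (by omega)) hkb.mem_innerBonds_thicken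
  -- Trace the exploration back to where it entered `E`. The first bond inside cannot lie in the
  -- (r-2)-thickening, since its predecessor would then lie in `E`.
  have hreach : ∀ f ∈ closedReach E ω, f ∈ E → ω f = false ∧
      ∃ k', (closedGraph E ω).Reachable f k' ∧ k' ∉ innerBonds (thicken Λ (r - 2)) := by
    intro f hf
    refine closedReach_induction (P := fun f => f ∈ E → ω f = false ∧
      ∃ k', (closedGraph E ω).Reachable f k' ∧ k' ∉ innerBonds (thicken Λ (r - 2)))
      (fun e he h => absurd h he) (fun e _ hP f hef hωf hfE => ⟨hωf, ?_⟩) hf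
    by_cases heE : e ∈ E
    · obtain ⟨hωe, k', hek', hk'⟩ := hP heE
      refine ⟨k', ?_, hk'⟩
      by_cases hfe : f = e
      · rwa [hfe]
      · have hadj : (closedGraph E ω).Adj f e := ⟨hfe, hef.symm, ⟨hfE, hωf⟩, ⟨heE, hωe⟩⟩
        exact hadj.reachable.trans hek'
    · refine ⟨f, .refl _, fun hf' => heE ?_⟩
      have := hef.symm.mem_innerBonds_thicken hf'
      rwa [show r - 2 + 1 = r - 1 by omega] at this
  obtain ⟨hωk, k', hkk', hk'⟩ := hreach k hk hkE
  obtain ⟨w, hw⟩ := hkk'.exists_isPath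
  -- The path goes from the 2-thickening to outside the (r-2)-thickening, one layer per step. It has
  -- at least r - 3 steps, hence at least r - 2 bonds.
  have hlen : r - 2 < 2 + w.length := by
    by_contra! hle
    exact hk' (innerBonds_mono (thicken_mono Λ hle)
      (mem_innerBonds_thicken_of_walk w hkb.mem_innerBonds_thicken))
  have hchain : (w.support.take (r - 2)).IsChain fun a b => b ∈ N a :=
    (w.isChain_adj_support.imp fun _ _ h => hN _ _ h.2.1).take _
  refine ⟨w.support.take (r - 2), ?_, hw.support_nodup.sublist (List.take_sublist _ _),
    fun e he => closed_of_mem_support ⟨hkE, hωk⟩ w e (List.mem_of_mem_take he)⟩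
  obtain ⟨n, hn⟩ : ∃ n, r - 2 = n + 1 := ⟨r - 3, by omega⟩
  rw [hn, ← SimpleGraph.Walk.cons_tail_support, List.take_succ_cons] at hchain ⊢
  have := mem_chainsFrom hN0 hchain
  have hl : (w.support.tail.take n).length = n := by
    rw [List.length_take, List.length_tail, SimpleGraph.Walk.length_support]
    omega
  rwa [hl] at this

-- Union bound over the starting bonds and the chains of `exists_closed_chain`. The chains have no
-- repetitions, so `expect_closed_le` gives the full power r - 2.
open Classical in
theorem expect_not_subset_unexplored_le (hd : 2 ≤ d) (hp : 0 < p) (hp1 : p ≤ 1) (hq : 1 ≤ q)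
    (Λ : Finset (Fin d → ℤ)) (r : ℕ) (η : Config d) :
    expect p q (innerBonds (thicken Λ (r - 1))) η
        (fun ω => if innerBonds Λ ⊆ unexplored (innerBonds (thicken Λ (r - 1))) ω then 0 else 1) ≤
      2 * d * (boundary Λ).ncard * (4 ^ d * (q * (1 - p) / p)) ^ (r - 2) := by
  set E := innerBonds (thicken Λ (r - 1)) with hE
  set t := q * (1 - p) / p with ht
  have ht0 : 0 ≤ t := div_nonneg (mul_nonneg (by linarith) (by linarith)) hp.le
  choose N hNcard hN0 hN using fun e : Bond d => exists_sqAdj_finset hd e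
  obtain ⟨S, hScard, hS⟩ := exists_touchesBoundary_finset Λ
  let P : Bond d → Finset (List (Bond d)) := fun f =>
    (chainsFrom N (r - 2) f).filter fun l => l.Nodup ∧ ∀ e ∈ l, e ∈ E
  let c : List (Bond d) → Config d → ℝ := fun l ω =>
    if ∀ e ∈ l.toFinset, ω e = false then 1 else 0
  have hc0 : ∀ l ω, 0 ≤ c l ω := fun l ω => by
    simp only [c]; split_ifs <;> norm_num
  have hle : ∀ ω, (if innerBonds Λ ⊆ unexplored E ω then (0 : ℝ) else 1) ≤
      ∑ f ∈ S, ∑ l ∈ P f, c l ω := by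
    intro ω
    split_ifs with h
    · exact Finset.sum_nonneg fun f _ => Finset.sum_nonneg fun l _ => hc0 l ω
    · obtain ⟨f, hf, l, hl, hnd, hcl⟩ := exists_closed_chain hN0 hN h
      have h1 : c l ω = 1 := if_pos fun e he => (hcl e (List.mem_toFinset.1 he)).2
      rw [← h1]
      refine le_trans ?_ (Finset.single_le_sum
        (fun f _ => Finset.sum_nonneg fun l _ => hc0 l ω) (hS f hf))
      exact Finset.single_le_sum (f := fun l => c l ω) (fun l _ => hc0 l ω)
        (Finset.mem_filter.2 ⟨hl, hnd, fun e he => (hcl e he).1⟩)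
  have hterm : ∀ f, ∀ l ∈ P f, expect p q E η (c l) ≤ t ^ (r - 2) := by
    intro f l hl
    obtain ⟨hl, hnd, hlE⟩ := Finset.mem_filter.1 hl
    have := expect_closed_le hp hp1 hq (S := l.toFinset)
      (fun e he => hlE e (List.mem_toFinset.1 he)) η
    rwa [List.toFinset_card_of_nodup hnd, length_of_mem_chainsFrom hl] at this
  calc expect p q E η (fun ω => if innerBonds Λ ⊆ unexplored E ω then 0 else 1)
      ≤ expect p q E η (fun ω => ∑ f ∈ S, ∑ l ∈ P f, c l ω) :=
        expect_mono hp hp1 hq fun ζ => hle _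
    _ = ∑ f ∈ S, ∑ l ∈ P f, expect p q E η (c l) := by
        rw [expect_sum]
        exact Finset.sum_congr rfl fun f _ => expect_sum _ _ _ _
    _ ≤ ∑ f ∈ S, (4 ^ d) ^ (r - 2) * t ^ (r - 2) := by
        refine Finset.sum_le_sum fun f _ => ?_
        refine (Finset.sum_le_card_nsmul _ _ _ (hterm f)).trans ?_
        rw [nsmul_eq_mul]
        refine mul_le_mul_of_nonneg_right ?_ (pow_nonneg ht0 _)
        exact_mod_cast (Finset.card_filter_le _ _).trans (card_chainsFrom_le hNcard _ f)
    _ = S.card * (4 ^ d * t) ^ (r - 2) := by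
        rw [Finset.sum_const, nsmul_eq_mul, mul_pow]
    _ ≤ _ := by
        refine mul_le_mul_of_nonneg_right ?_ (by positivity)
        exact_mod_cast hScard

/-! ### From finite-volume expectations to measures on Ω. -/

theorem finiteMeasure_apply (hp : 0 < p) (hp1 : p ≤ 1) (hq : 1 ≤ q) (E : Finset (Bond d))
    (η : Config d) {A : Set (Config d)} (hA : MeasurableSet A) :
    finiteMeasure p q E η A = ENNReal.ofReal (expect p q E η (ind A)) := by
  have hZ := partitionFunction_pos hp hp1 hq E η
  rw [finiteMeasure, Measure.finsetSum_apply, expect, Finset.sum_div,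
    ENNReal.ofReal_sum_of_nonneg fun ζ _ => div_nonneg
      (mul_nonneg (weight_nonneg hp hp1 hq _ _) (ind_nonneg A _)) hZ.le]
  refine Finset.sum_congr rfl fun ζ _ => ?_
  rw [Measure.smul_apply, Measure.dirac_apply' _ hA, smul_eq_mul]
  by_cases h : glue E ζ η ∈ A
  · simp [ind, h]
  · simp [ind, h]

theorem expect_ind_nonneg (hp : 0 < p) (hp1 : p ≤ 1) (hq : 1 ≤ q) (E : Finset (Bond d))
    (η : Config d) (A : Set (Config d)) : 0 ≤ expect p q E η (ind A) :=
  (expect_const hp hp1 hq E η 0).symm.trans_le (expect_mono hp hp1 hq fun _ => ind_nonneg A _)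

theorem integral_ind (φ : Measure (Config d)) {X : Set (Config d)} (hX : MeasurableSet X) :
    ∫ ω, ind X ω ∂φ = φ.real X := by
  simp only [ind]
  exact integral_indicator_one hX

theorem integral_ind_finiteMeasure (hp : 0 < p) (hp1 : p ≤ 1) (hq : 1 ≤ q) (E : Finset (Bond d))
    (η : Config d) {A : Set (Config d)} (hA : MeasurableSet A) :
    ∫ ω, ind A ω ∂(finiteMeasure p q E η) = expect p q E η (ind A) := by
  rw [integral_ind _ hA, measureReal_def, finiteMeasure_apply hp hp1 hq E η hA,
    ENNReal.toReal_ofReal (expect_ind_nonneg hp hp1 hq E η A)]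

/-- The sets determined by the bonds of 𝔼_Λ form a σ-field that contains the generating cylinders.
-/
theorem dependsOnBonds_of_measurableSet {Λ : Finset (Fin d → ℤ)} {A : Set (Config d)}
    (hA : MeasurableSet[sigmaField Λ] A) : DependsOnBonds A (innerBonds Λ) := by
  let m : MeasurableSpace (Config d) :=
    { MeasurableSet' := fun A => DependsOnBonds A (innerBonds Λ)
      measurableSet_empty := fun _ _ _ => Iff.rfl
      measurableSet_compl := fun A hA ω ω' h => not_congr (hA ω ω' h)
      measurableSet_iUnion := fun f hf ω ω' h => by
        simp only [Set.mem_iUnion]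
        exact exists_congr fun i => hf i ω ω' h }
  have hle : sigmaField Λ ≤ m := by
    refine iSup₂_le fun e he => ?_
    rintro _ ⟨s, _, rfl⟩ ω ω' h
    rw [Set.mem_preimage, Set.mem_preimage, h e he]
  exact hle A hA

theorem DependsOnBonds.isClopen {A : Set (Config d)} {L : Finset (Bond d)}
    (hA : DependsOnBonds A L) : IsClopen A := by
  let r : Config d → (L → Bool) := fun ω e => ω e
  have hr : Continuous r := continuous_pi fun e => continuous_apply _
  have : A = r ⁻¹' (r '' A) := by
    refine (Set.subset_preimage_image r A).antisymm ?_
    rintro ω ⟨ω', hω', h⟩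
    exact (hA ω' ω fun e he => congrFun h ⟨e, he⟩).1 hω'
  rw [this]
  exact (isClopen_discrete _).preimage hr

theorem DependsOnBonds.measurableSet {A : Set (Config d)} {L : Finset (Bond d)}
    (hA : DependsOnBonds A L) : MeasurableSet A := by
  let r : Config d → (L → Bool) := fun ω e => ω e
  have hr : Measurable r := measurable_pi_lambda _ fun e => measurable_pi_apply _
  have : A = r ⁻¹' (r '' A) := by
    refine (Set.subset_preimage_image r A).antisymm ?_
    rintro ω ⟨ω', hω', h⟩
    exact (hA ω' ω fun e he => congrFun h ⟨e, he⟩).1 hω'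
  rw [this]
  exact hr (Set.toFinite _).measurableSet

theorem DependsOnBonds.continuous_ind {A : Set (Config d)} {L : Finset (Bond d)}
    (hA : DependsOnBonds A L) : Continuous (ind A) :=
  continuous_one.indicator fun a ha => by rw [hA.isClopen.frontier_eq] at ha; exact ha.elim

open Classical in
theorem DependsOnBonds.inter {A B : Set (Config d)} {L M : Finset (Bond d)}
    (hA : DependsOnBonds A L) (hB : DependsOnBonds B M) : DependsOnBonds (A ∩ B) (L ∪ M) :=
  fun ω ω' h => and_congr (hA ω ω' fun e he => h e (Finset.mem_union_left _ he))
    (hB ω ω' fun e he => h e (Finset.mem_union_right _ he))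

theorem ind_glue_of_disjoint {E M : Finset (Bond d)} (hEM : Disjoint E M) {B : Set (Config d)}
    (hB : DependsOnBonds B M) (ζ : E → Bool) (η : Config d) : ind B (glue E ζ η) = ind B η := by
  have := hB (glue E ζ η) η fun e he => glue_apply_notMem (Finset.disjoint_right.1 hEM he) _ _
  by_cases h : η ∈ B
  · simp [ind, h, this.2 h]
  · simp [ind, h, mt this.1 h]

theorem expect_ind_inter {E M : Finset (Bond d)} (hEM : Disjoint E M) {A B : Set (Config d)}
    (hB : DependsOnBonds B M) (η : Config d) :
    expect p q E η (ind (A ∩ B)) = ind B η * expect p q E η (ind A) := by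
  rw [← expect_const_mul]
  refine expect_congr fun ζ => ?_
  rw [← ind_glue_of_disjoint hEM hB ζ η]
  simp only [ind, Set.inter_indicator_one, Pi.mul_apply]
  ring

theorem exists_subset_box (D : Finset (Fin d → ℤ)) : ∃ n₀, ∀ n ≥ n₀, D ⊆ box d n := by
  refine ⟨D.sup fun x => Finset.univ.sup fun i => (x i).natAbs, fun n hn x hx => ?_⟩
  have h1 : (Finset.univ.sup fun i => (x i).natAbs) ≤ n :=
    (Finset.le_sup (f := fun x : Fin d → ℤ => Finset.univ.sup fun i => (x i).natAbs) hx).trans hn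
  refine Fintype.mem_piFinset.2 fun i => Finset.mem_Icc.2 ?_
  have h2 : (x i).natAbs ≤ n :=
    (Finset.le_sup (f := fun i => (x i).natAbs) (Finset.mem_univ i)).trans h1
  omega

theorem IsInfiniteVolumeLimit.tendsto_expect (hp : 0 < p) (hp1 : p ≤ 1) (hq : 1 ≤ q)
    {φ : Measure (Config d)} {β : Bool} (hφ : IsInfiniteVolumeLimit p q β φ)
    {X : Set (Config d)} {K : Finset (Bond d)} (hX : DependsOnBonds X K) :
    Tendsto (fun n : ℕ => expect p q (innerBonds (box d n)) (fun _ => β) (ind X)) atTop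
      (𝓝 (φ.real X)) := by
  rw [← integral_ind φ hX.measurableSet]
  refine (hφ.2 (ind X) hX.continuous_ind).congr fun n => ?_
  exact integral_ind_finiteMeasure hp hp1 hq _ _ hX.measurableSet

/-- A random-cluster measure or infinite-volume limit lies between the free and wired measures on
`D`, conditionally on events that do not depend on the bonds in `D`. -/
theorem sandwich (hp : 0 < p) (hp1 : p ≤ 1) (hq : 1 ≤ q) {φ : Measure (Config d)}
    (hφ : IsRandomCluster p q φ ∨ ∃ b : Bool, IsInfiniteVolumeLimit p q b φ)
    (D : Finset (Fin d → ℤ)) {L M : Finset (Bond d)} (hDM : Disjoint (innerBonds D) M)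
    {A B : Set (Config d)} (hA : IsUpperSet A) (hAL : DependsOnBonds A L)
    (hB : DependsOnBonds B M) :
    expect p q (innerBonds D) (fun _ => false) (ind A) * φ.real B ≤ φ.real (A ∩ B) ∧
      φ.real (A ∩ B) ≤ expect p q (innerBonds D) (fun _ => true) (ind A) * φ.real B := by
  classical
  set E := innerBonds D with hE
  set a := expect p q E (fun _ => false) (ind A)
  set b := expect p q E (fun _ => true) (ind A)
  have ha : ∀ η, a ≤ expect p q E η (ind A) := fun η =>
    expect_mono_boundary hp hp1 hq E (fun _ => Bool.false_le _) (ind_nonneg A) (ind_mono hA)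
  have hb : ∀ η, expect p q E η (ind A) ≤ b := fun η =>
    expect_mono_boundary hp hp1 hq E (fun _ => Bool.le_true _) (ind_nonneg A) (ind_mono hA)
  have hAm := hAL.measurableSet
  have hBm := hB.measurableSet
  have ha0 : 0 ≤ a := expect_ind_nonneg hp hp1 hq _ _ _
  have hb0 : 0 ≤ b := expect_ind_nonneg hp hp1 hq _ _ _
  rcases hφ with ⟨hprob, hdlr⟩ | ⟨β, hprob, hlim⟩
  · have hind : ∀ c : ℝ, ENNReal.ofReal c * φ B =
        ∫⁻ η, B.indicator (fun _ => ENNReal.ofReal c) η ∂φ := fun c =>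
      (lintegral_indicator_const hBm _).symm
    have hab := hdlr (A ∩ B) (hAm.inter hBm) D
    have happ : ∀ η, finiteMeasure p q E η (A ∩ B) =
        B.indicator (fun η => ENNReal.ofReal (expect p q E η (ind A))) η := by
      intro η
      rw [finiteMeasure_apply hp hp1 hq _ _ (hAm.inter hBm), expect_ind_inter hDM hB]
      by_cases h : η ∈ B <;> simp [ind, h]
    simp only [← hE, happ] at hab
    have h1 : ENNReal.ofReal a * φ B ≤ φ (A ∩ B) := by
      rw [hind, hab]
      refine lintegral_mono fun η => ?_
      exact Set.indicator_le_indicator (ENNReal.ofReal_le_ofReal (ha η))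
    have h2 : φ (A ∩ B) ≤ ENNReal.ofReal b * φ B := by
      rw [hind, hab]
      refine lintegral_mono fun η => ?_
      exact Set.indicator_le_indicator (ENNReal.ofReal_le_ofReal (hb η))
    have h1' := ENNReal.toReal_mono (measure_ne_top _ _) h1
    have h2' := ENNReal.toReal_mono
      (ENNReal.mul_ne_top ENNReal.ofReal_ne_top (measure_ne_top _ _)) h2
    rw [ENNReal.toReal_mul, ENNReal.toReal_ofReal ha0] at h1'
    rw [ENNReal.toReal_mul, ENNReal.toReal_ofReal hb0] at h2'
    exact ⟨h1', h2'⟩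
  -- For a limit measure the bounds hold in every box containing `D`, by the spatial Markov
  -- property, and pass to the limit because indicators of cylinder events are continuous.
  · have htends := fun {X : Set (Config d)} {K : Finset (Bond d)} (hX : DependsOnBonds X K) =>
      IsInfiniteVolumeLimit.tendsto_expect hp hp1 hq ⟨hprob, hlim⟩ hX
    obtain ⟨n₀, hn₀⟩ := exists_subset_box D
    have hfin : ∀ n ≥ n₀,
        a * expect p q (innerBonds (box d n)) (fun _ => β) (ind B) ≤
          expect p q (innerBonds (box d n)) (fun _ => β) (ind (A ∩ B)) ∧
        expect p q (innerBonds (box d n)) (fun _ => β) (ind (A ∩ B)) ≤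
          b * expect p q (innerBonds (box d n)) (fun _ => β) (ind B) := by
      intro n hn
      rw [← expect_expect hp hp1 hq (innerBonds_mono (hn₀ n hn)) _ (ind (A ∩ B)),
        ← expect_const_mul, ← expect_const_mul]
      constructor <;> refine expect_mono hp hp1 hq fun ζ => ?_ <;>
        rw [expect_ind_inter hDM hB, mul_comm (ind B _)]
      · exact mul_le_mul_of_nonneg_right (ha _) (ind_nonneg B _)
      · exact mul_le_mul_of_nonneg_right (hb _) (ind_nonneg B _)
    have tAB := htends (hAL.inter hB)
    have tB := htends hB
    exact ⟨le_of_tendsto_of_tendsto (tB.const_mul a) tAB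
        (eventually_atTop.2 ⟨n₀, fun n hn => (hfin n hn).1⟩),
      le_of_tendsto_of_tendsto tAB (tB.const_mul b)
        (eventually_atTop.2 ⟨n₀, fun n hn => (hfin n hn).2⟩)⟩

/-! ### Covariance bounds. -/

theorem disjoint_innerBonds_thicken {Λ₁ Λ₂ : Finset (Fin d → ℤ)} (h : 1 ≤ setDist Λ₁ Λ₂) :
    Disjoint (innerBonds (thicken Λ₁ (setDist Λ₁ Λ₂ - 1))) (innerBonds Λ₂) := by
  rw [Finset.disjoint_left]
  intro e he he'
  rw [mem_innerBonds] at he he'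
  obtain ⟨x, i, rfl⟩ := exists_eq_bond e
  obtain ⟨y, hy, hyx⟩ := mem_thicken.1 (he x (mem_bond.2 (.inl rfl)))
  have : setDist Λ₁ Λ₂ ≤ l1Dist y x := Nat.sInf_le ⟨y, hy, x, he' x (mem_bond.2 (.inl rfl)), rfl⟩
  omega

theorem abs_cov_le_of_isUpperSet (hd : 2 ≤ d) (hp : 0 < p) (hp1 : p ≤ 1) (hq : 1 ≤ q)
    {φ : Measure (Config d)}
    (hφ : IsRandomCluster p q φ ∨ ∃ b : Bool, IsInfiniteVolumeLimit p q b φ)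
    {Λ₁ Λ₂ : Finset (Fin d → ℤ)} (h : 1 ≤ setDist Λ₁ Λ₂) {A B : Set (Config d)}
    (hA : IsUpperSet A) (hA₁ : DependsOnBonds A (innerBonds Λ₁))
    (hB₂ : DependsOnBonds B (innerBonds Λ₂)) :
    |φ.real (A ∩ B) - φ.real A * φ.real B| ≤
      2 * d * (boundary Λ₁).ncard * (4 ^ d * (q * (1 - p) / p)) ^ (setDist Λ₁ Λ₂ - 2) := by
  have hprob : IsProbabilityMeasure φ := by
    rcases hφ with h | ⟨_, h⟩
    exacts [h.1, h.1]
  have h1 := sandwich hp hp1 hq hφ (thicken Λ₁ (setDist Λ₁ Λ₂ - 1))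
    (disjoint_innerBonds_thicken h) hA hA₁ hB₂
  -- With the sure event in place of `B`, the same bounds hold for φ(A); subtracting gives a gap
  -- multiplied by φ(B) ≤ 1.
  have h2 := sandwich hp hp1 hq hφ (thicken Λ₁ (setDist Λ₁ Λ₂ - 1)) (M := ∅) (B := Set.univ)
    (Finset.disjoint_empty_right _) hA hA₁ (fun _ _ _ => Iff.rfl)
  rw [Set.inter_univ, probReal_univ, mul_one, mul_one] at h2
  have h3 := (expect_wired_sub_expect_le hp hp1 hq
    (E := innerBonds (thicken Λ₁ (setDist Λ₁ Λ₂ - 1))) (fun _ => false) hA hA₁).trans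
    (expect_not_subset_unexplored_le hd hp hp1 hq Λ₁ (setDist Λ₁ Λ₂) fun _ => false)
  refine le_trans ?_ h3
  have hB0 : 0 ≤ φ.real B := measureReal_nonneg
  have hB1 : φ.real B ≤ 1 := measureReal_le_one
  rw [abs_le]
  constructor <;> nlinarith

theorem abs_cov_le_one (φ : Measure (Config d)) [IsProbabilityMeasure φ] (A B : Set (Config d)) :
    |φ.real (A ∩ B) - φ.real A * φ.real B| ≤ 1 := by
  have h1 : φ.real (A ∩ B) ≤ 1 := measureReal_le_one
  have h2 : φ.real A * φ.real B ≤ 1 := mul_le_one₀ measureReal_le_one measureReal_nonneg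
    measureReal_le_one
  have h3 : 0 ≤ φ.real (A ∩ B) := measureReal_nonneg
  have h4 : 0 ≤ φ.real A * φ.real B := mul_nonneg measureReal_nonneg measureReal_nonneg
  rw [abs_le]
  constructor <;> linarith

theorem abs_cov_le (hd : 2 ≤ d) (hp : 0 < p) (hp1 : p ≤ 1) (hq : 1 ≤ q)
    {φ : Measure (Config d)}
    (hφ : IsRandomCluster p q φ ∨ ∃ b : Bool, IsInfiniteVolumeLimit p q b φ)
    {Λ₁ Λ₂ : Finset (Fin d → ℤ)} (h : 1 ≤ setDist Λ₁ Λ₂) {A B : Set (Config d)}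
    (hA : IsMonotoneEvent A) (hA₁ : DependsOnBonds A (innerBonds Λ₁))
    (hB₂ : DependsOnBonds B (innerBonds Λ₂)) :
    |φ.real (A ∩ B) - φ.real A * φ.real B| ≤
      2 * d * (boundary Λ₁).ncard * (4 ^ d * (q * (1 - p) / p)) ^ (setDist Λ₁ Λ₂ - 2) := by
  have hprob : IsProbabilityMeasure φ := by
    rcases hφ with h | ⟨_, h⟩
    exacts [h.1, h.1]
  rcases hA with hA | hA
  · exact abs_cov_le_of_isUpperSet hd hp hp1 hq hφ h hA hA₁ hB₂
  · have hc : DependsOnBonds Aᶜ (innerBonds Λ₁) := fun ω ω' h => not_congr (hA₁ ω ω' h)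
    have := abs_cov_le_of_isUpperSet hd hp hp1 hq hφ h hA.compl hc hB₂
    have e1 : φ.real Aᶜ = 1 - φ.real A := probReal_compl_eq_one_sub hA₁.measurableSet
    have e2 : φ.real (A ∩ B) + φ.real (Aᶜ ∩ B) = φ.real B := by
      rw [Set.inter_comm A, Set.inter_comm Aᶜ, ← Set.sdiff_eq]
      exact measureReal_inter_add_sdiff hA₁.measurableSet
    have e3 : φ.real (Aᶜ ∩ B) - φ.real Aᶜ * φ.real B =
        -(φ.real (A ∩ B) - φ.real A * φ.real B) := by
      rw [e1]; linear_combination e2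
    rwa [e3, abs_neg] at this

end RandomCluster

open RandomCluster in
theorem mainTheorem12 (d : ℕ) (hd : 2 ≤ d) (p q : ℝ) (hq : 1 ≤ q)
    (hp : q / (q + 1 / (4 : ℝ) ^ d) < p) (hp1 : p ≤ 1) :
    ∃ C α : ℝ, 0 < C ∧ 0 < α ∧
      ∀ φ : MeasureTheory.Measure (RandomCluster.Config d),
        (RandomCluster.IsRandomCluster p q φ ∨
          ∃ b : Bool, RandomCluster.IsInfiniteVolumeLimit p q b φ) →
        ∀ Λ₁ Λ₂ : Finset (Fin d → ℤ),
          RandomCluster.IsConnectedVolume Λ₁ → RandomCluster.IsConnectedVolume Λ₂ →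
          ∀ A B : Set (RandomCluster.Config d),
            RandomCluster.IsMonotoneEvent A → RandomCluster.IsMonotoneEvent B →
            MeasurableSet[RandomCluster.sigmaField Λ₁] A →
            MeasurableSet[RandomCluster.sigmaField Λ₂] B →
            |φ.real (A ∩ B) - φ.real A * φ.real B| ≤
              C * ((RandomCluster.boundary Λ₁).ncard : ℝ) *
                Real.exp (-(α * (RandomCluster.setDist Λ₁ Λ₂ : ℝ))) := by
  have h4 : (0 : ℝ) < 1 / (4 : ℝ) ^ d := by positivity
  have hp0 : 0 < p := lt_of_le_of_lt (by positivity) hp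
  have hlt : 4 ^ d * (q * (1 - p) / p) < 1 := by
    rw [div_lt_iff₀ (by linarith)] at hp
    rw [← mul_div_assoc, div_lt_one hp0]
    have h5 : q * (1 - p) < p * (1 / (4 : ℝ) ^ d) := by linarith
    calc (4 : ℝ) ^ d * (q * (1 - p)) < 4 ^ d * (p * (1 / (4 : ℝ) ^ d)) :=
          mul_lt_mul_of_pos_left h5 (by positivity)
      _ = p := by field_simp
  have ht0 : 0 ≤ 4 ^ d * (q * (1 - p) / p) :=
    mul_nonneg (by positivity) (div_nonneg (mul_nonneg (by linarith) (by linarith)) hp0.le)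
  -- The value 1/2 keeps `s` positive when p = 1, so that its logarithm gives a decay rate.
  set s : ℝ := max (4 ^ d * (q * (1 - p) / p)) (1 / 2) with hs
  have hs0 : 0 < s := lt_of_lt_of_le (by norm_num) (le_max_right _ _)
  have hs1 : s < 1 := max_lt hlt (by norm_num)
  have hd0 : (1 : ℝ) ≤ d := by exact_mod_cast (by omega : 1 ≤ d)
  have hss : 1 ≤ (s ^ 2)⁻¹ := (one_le_inv₀ (by positivity)).2 (pow_le_one₀ hs0.le hs1.le)
  have hC1 : 1 ≤ 2 * d * (s ^ 2)⁻¹ := by nlinarith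
  refine ⟨2 * d * (s ^ 2)⁻¹, -Real.log s, by linarith, neg_pos.2 (Real.log_neg hs0 hs1), ?_⟩
  intro φ hφ Λ₁ Λ₂ h₁ h₂ A B hA hB hA₁ hB₂
  have hprob : IsProbabilityMeasure φ := by
    rcases hφ with h | ⟨_, h⟩
    exacts [h.1, h.1]
  have hΛ₁ : Λ₁.Nonempty := by
    obtain ⟨x⟩ := h₁.nonempty
    exact ⟨x, x.2⟩
  have hn : (1 : ℝ) ≤ (boundary Λ₁).ncard := by
    exact_mod_cast boundary_ncard_pos (by omega) hΛ₁
  set r := setDist Λ₁ Λ₂ with hr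
  have hexp : Real.exp (-(-Real.log s * (r : ℝ))) = s ^ r := by
    rw [neg_mul, neg_neg, mul_comm, Real.exp_nat_mul, Real.exp_log hs0]
  rw [hexp]
  rcases Nat.eq_zero_or_pos r with h0 | hpos
  -- At distance zero the trivial bound 1 suffices, since C ≥ 1 and ∂Λ₁ is nonempty.
  · rw [h0, pow_zero, mul_one]
    exact (abs_cov_le_one φ A B).trans (one_le_mul_of_one_le_of_one_le hC1 hn)
  · refine (abs_cov_le hd hp0 hp1 hq hφ hpos hA (dependsOnBonds_of_measurableSet hA₁)
      (dependsOnBonds_of_measurableSet hB₂)).trans ?_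
    -- The factor s⁻² in C absorbs the shift in r - 2, including the truncation at r = 1.
    have hpow : (4 ^ d * (q * (1 - p) / p)) ^ (r - 2) ≤ (s ^ 2)⁻¹ * s ^ r := by
      refine (pow_le_pow_left₀ ht0 (le_max_left _ (1 / 2)) _).trans ?_
      rw [← hs, inv_mul_eq_div, le_div_iff₀ (by positivity), ← pow_add]
      exact pow_le_pow_of_le_one hs0.le hs1.le (by omega)
    calc 2 * d * (boundary Λ₁).ncard * (4 ^ d * (q * (1 - p) / p)) ^ (r - 2)
        ≤ 2 * d * (boundary Λ₁).ncard * ((s ^ 2)⁻¹ * s ^ r) :=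
          mul_le_mul_of_nonneg_left hpow (by positivity)
      _ = _ := by ring
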